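/- Let $\mathbb{F}_q$ be a finite field with $q$ elements, let $X$ be a nonsingular projective curve over $\mathbb{F}_q$, let $\infty$ be a closed point of $X$, and let $A$ be the ring of functions on $X$ that are regular everywhere except possibly at $\infty$. Let $K$ be a finitely generated field extension of $\mathbb{F}_q$, let $i:A\to K$ be a homomorphism of $\mathbb{F}_q$-algebras, and let $K\{\tau\}$ be the ring of polynomials $\sum_j a_j\tau^j$ in $\tau$ with coefficients in $K$ and with $\tau a=a^q\tau$; it operates on every extension field of $K$ by $\tau(x)=x^q$. A Drinfeld module is a ring homomorphism $\phi:A\to K\{\tau\}$, $a\mapsto\phi_a$, such that the coefficient of $\tau^0$ in $\phi_a$ is $i(a)$ for every $a\in A$, and $\phi_a\notin K$ for some $a\in A$. It is of finite characteristic if $\ker(i)\neq\{0\}$. Let $V\subseteq\mathbb{P}^M$ be a normal projective variety with function field $K$, defined over a finite field $\mathbb{F}\subseteq K$ that contains $\mathbb{F}_q$. Let $M_K$ be the set of the valuations of $K$, normalized to have value group $\mathbb{Z}$, that are associated with the irreducible divisors (subvarieties of codimension $1$) of $V$, and for $v\in M_K$ let $\deg(v)$ be the projective degree in $\mathbb{P}^M$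 of the corresponding divisor. For a finite extension $L$ of $K$ let $M_L$, the set of places of $L$, be the set of the normalized valuations of $L$ that are associated with the irreducible divisors of the normalization of $V$ in $L$. For $w\in M_L$, $x\in L$ and a nonconstant $a\in A$ (that is, $a$ is transcendental over $\mathbb{F}_q$) put $$V_w(x)=\lim_{n\to\infty}\frac{\min\{0,w(\phi_{a^n}(x))\}}{\deg(\phi_{a^n})},\qquad \hat h_w(x)=-\frac{\deg(v)\,f(w|v)}{[L:K]}\,V_w(x),$$ where $v\in M_K$ is the place below $w$, $f(w|v)$ is the residue degree, and $\deg(\sum_{j=0}^r a_j\tau^j)=q^r$ if $a_r\neq0$. (These do not depend on the choice of $a$.) Theorem. Let $\phi:A\to K\{\tau\}$ be a Drinfeld module of finite characteristic. There is a constant $k>0$, depending only on $\phi$, and, for every $V\subseteq\mathbb{P}^M$ as above, a constant $C>0$, depending only on $\phi$ and on the model $V\subseteq\mathbb{P}^M$ over $\mathbb{F}$ with respect to which the local heights are formed, such that the following holds. If $x\in K^{\mathrm{alg}}$, $d=[K(x):K]$, and $v\in M_{K(x)}$ is a place of $K(x)$ with $\hat h_v(x)>0$, then $$\hat h_v(x)\ge\frac{C}{d^k}.$$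 -/

import Mathlib

open scoped WithZero

noncomputable section

/-! ### Twisted polynomials `K{τ}`, where `τ` is the `q`-power Frobenius -/

/-- The action of `ℕ` on a field extension `K` of the finite field `Fq`
through the powers of the `q`-Frobenius: `n` acts as `x ↦ x ^ (q ^ n)`, `q = |Fq|`. -/
@[reducible] def frobeniusAction (Fq K : Type*) [Field Fq] [Finite Fq] [Field K] [Algebra Fq K] :
    MulSemiringAction (Multiplicative ℕ) K where
  smul n x := x ^ (Nat.card Fq ^ n.toAdd)
  one_smul x := by
    change x ^ (Nat.card Fq ^ 0) = x
    simp
  mul_smul m n x := by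
    change x ^ (Nat.card Fq ^ (m.toAdd + n.toAdd)) =
      (x ^ (Nat.card Fq ^ n.toAdd)) ^ (Nat.card Fq ^ m.toAdd)
    rw [← pow_mul, pow_add, mul_comm]
  smul_zero n := by
    change (0 : K) ^ (Nat.card Fq ^ n.toAdd) = 0
    exact zero_pow (pow_ne_zero _ Nat.card_pos.ne')
  smul_add n x y := by
    change (x + y) ^ (Nat.card Fq ^ n.toAdd) =
      x ^ (Nat.card Fq ^ n.toAdd) + y ^ (Nat.card Fq ^ n.toAdd)
    have := Fintype.ofFinite Fq
    rw [Nat.card_eq_fintype_card]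
    induction n.toAdd with
    | zero => simp
    | succ k ih =>
      have h := map_add (FiniteField.frobeniusAlgHom Fq K)
        (x ^ (Fintype.card Fq ^ k)) (y ^ (Fintype.card Fq ^ k))
      simp only [FiniteField.coe_frobeniusAlgHom] at h
      rw [pow_succ, pow_mul, ih, pow_mul, pow_mul, h]
  smul_one n := by
    change (1 : K) ^ (Nat.card Fq ^ n.toAdd) = 1
    simp
  smul_mul n x y := by
    change (x * y) ^ (Nat.card Fq ^ n.toAdd) =
      x ^ (Nat.card Fq ^ n.toAdd) * y ^ (Nat.card Fq ^ n.toAdd)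
    rw [mul_pow]

/-- `K{τ}`: skew polynomials `∑ aₙ τⁿ` with coefficients in `K` and `τ a = a ^ q τ`. -/
def TwistedPoly (Fq K : Type*) [Field Fq] [Finite Fq] [Field K] [Algebra Fq K] : Type _ :=
  SkewPolynomial K

namespace TwistedPoly

variable {Fq K : Type*} [Field Fq] [Finite Fq] [Field K] [Algebra Fq K]

instance : Ring (TwistedPoly Fq K) :=
  letI : MulSemiringAction (Multiplicative ℕ) K := frobeniusAction Fq K
  inferInstanceAs (Ring (SkewPolynomial K))

/-- The coefficient of `τ ^ n`. -/
def coeff (f : TwistedPoly Fq K) (n : ℕ) : K := SkewPolynomial.coeff (R := K) f n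

/-- The finite set of exponents `n` such that `τ ^ n` has a nonzero coefficient. -/
def support (f : TwistedPoly Fq K) : Finset ℕ := SkewPolynomial.support (R := K) f

/-- The value at `x` of the operator `∑ aₙ τⁿ`, that is `∑ aₙ x ^ (q ^ n)`,
in an extension field `L` of `K`. -/
def eval (f : TwistedPoly Fq K) {L : Type*} [Field L] [Algebra K L] (x : L) : L :=
  ∑ n ∈ f.support, algebraMap K L (f.coeff n) * x ^ (Nat.card Fq ^ n)

/-- The degree of `∑ aₙ τⁿ` as an additive polynomial `∑ aₙ X ^ (q ^ n)` in `X`,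
that is `q ^ r`, where `r` is the degree in `τ`. -/
def deg (f : TwistedPoly Fq K) : ℕ := Nat.card Fq ^ f.support.sup id

end TwistedPoly

/-! ### The ring `A` -/

/-- A place of a function field `F` over `k`: a normalized discrete valuation of `F` that is
trivial on `k`. If `F` is a function field in one variable, these are the closed points of the
nonsingular projective curve over `k` with function field `F`. -/
structure CurvePlace (k F : Type*) [Field k] [Field F] [Algebra k F] where
  /-- the valuation, in multiplicative notation -/
  val : Valuation F ℤᵐ⁰
  surjective : Function.Surjective val
  le_one : ∀ c : k, val (algebraMap k F c) ≤ 1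

/-- The ring of functions that are regular at all places except possibly at `infty`. -/
def regularAwayFrom {k F : Type*} [Field k] [Field F] [Algebra k F] (infty : CurvePlace k F) :
    Subalgebra k F where
  carrier := {f | ∀ P : CurvePlace k F, P ≠ infty → P.val f ≤ 1}
  mul_mem' := fun ha hb P hP => by
    rw [map_mul]
    exact mul_le_one' (ha P hP) (hb P hP)
  add_mem' := fun ha hb P hP => P.val.map_add_le (ha P hP) (hb P hP)
  algebraMap_mem' := fun c P _ => P.le_one c

/-! ### Drinfeld modules -/

/-- A Drinfeld module over `i : A → K`: a ring homomorphism `φ : A → K{τ}` such that the constant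
coefficient of `φ a` is `i a`, and `φ` is not just `i`, i.e. some `φ a` is not a constant of
`K{τ}`. (It is automatically `Fq`-linear: it maps `Fq` to finite fields in `K{τ}`, thus to
polynomials of degree `0` in `τ`.) -/
structure DrinfeldModule {Fq A K : Type*} [Field Fq] [Finite Fq] [CommRing A] [Algebra Fq A]
    [Field K] [Algebra Fq K] (i : A →ₐ[Fq] K) where
  /-- the homomorphism `a ↦ φ a` -/
  toRingHom : A →+* TwistedPoly Fq K
  coeff_zero : ∀ a : A, (toRingHom a).coeff 0 = i a
  nontrivial : ∃ a : A, ∃ n : ℕ, n ≠ 0 ∧ (toRingHom a).coeff n ≠ 0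

/-- `φ` is of finite characteristic if the kernel of `i` is nonzero. -/
def DrinfeldModule.IsFiniteCharacteristic {Fq A K : Type*} [Field Fq] [Finite Fq] [CommRing A]
    [Algebra Fq A] [Field K] [Algebra Fq K] {i : A →ₐ[Fq] K} (_φ : DrinfeldModule i) : Prop :=
  RingHom.ker i ≠ ⊥

/-! ### Projective models of `K`, their prime divisors, and degrees -/

/-- A normal projective variety `V ⊆ ℙ^M` over the field `k`, with function field `K`.
The variety is given by its generic point, with homogeneous coordinates
`coord 0, …, coord M` in `K`: it is the Zariski closure of this point, i.e. it is defined by the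
homogeneous polynomials over `k` that vanish at this point. -/
structure ProjectiveModel (k K : Type*) [Field k] [Field K] [Algebra k K] where
  /-- the dimension of the ambient projective space -/
  M : ℕ
  /-- the homogeneous coordinates of the generic point -/
  coord : Fin (M + 1) → K
  coord_ne_zero : coord ≠ 0
  /-- the function field of the variety is `K` -/
  adjoin_eq_top :
    IntermediateField.adjoin k {y : K | ∃ i j : Fin (M + 1), y = coord i / coord j} = ⊤
  /-- the affine coordinate rings of the standard affine charts are integrally closed -/
  normal : ∀ j, coord j ≠ 0 →
    IsIntegrallyClosed (Algebra.adjoin k {y : K | ∃ i : Fin (M + 1), y = coord i / coord j})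

namespace ProjectiveModel

variable {k K : Type*} [Field k] [Field K] [Algebra k K] (V : ProjectiveModel k K)

/-- The affine coordinate ring, inside `K`, of the chart of `V` on which the `j`-th coordinate is
not zero (for `coord j ≠ 0`; otherwise this chart is empty). -/
def chart (j : Fin (V.M + 1)) : Subalgebra k K :=
  Algebra.adjoin k {y : K | ∃ i : Fin (V.M + 1), y = V.coord i / V.coord j}

/-- The set `M_L` of normalized discrete valuations of `L` (in multiplicative notation, so that
`w x = exp (-ord x)`) that are associated with the irreducible divisors of the normalization `W`
of `V` in the extension field `L` of `K`. The variety `W` is covered by the spectra of the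
integral closures in `L` of the rings of the charts, and the divisors that meet such a
chart are the primes of height one of this integral closure. -/
def divisors (L : Type*) [Field L] [Algebra K L] : Set (Valuation L ℤᵐ⁰) :=
  {w | Function.Surjective w ∧ ∃ j : Fin (V.M + 1), V.coord j ≠ 0 ∧
    (∀ b : integralClosure (V.chart j) L, w b ≤ 1) ∧
    ∃ P : Ideal (integralClosure (V.chart j) L), P.IsPrime ∧ P.height = 1 ∧
      ∀ b : integralClosure (V.chart j) L, b ∈ P ↔ w b < 1}

/-- The largest value (multiplicatively) of a homogeneous coordinate of the generic point. -/
def maxVal (v : Valuation K ℤᵐ⁰) : ℤᵐ⁰ := Finset.univ.sup fun i => v (V.coord i)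

lemma maxVal_pos (v : Valuation K ℤᵐ⁰) : 0 < V.maxVal v := by
  obtain ⟨i, hi⟩ := Function.ne_iff.mp V.coord_ne_zero
  exact lt_of_lt_of_le (zero_lt_iff.mpr ((Valuation.ne_zero_iff v).mpr hi))
    (Finset.le_sup (f := fun i => v (V.coord i)) (Finset.mem_univ i))

lemma val_base_le_one [Finite k] (v : Valuation K ℤᵐ⁰) (c : k) :
    v (algebraMap k K c) ≤ 1 := by
  by_contra! h
  have hinj : Function.Injective fun n : ℕ => c ^ n := by
    intro m n hmn
    have h1 : v (algebraMap k K c) ^ m = v (algebraMap k K c) ^ n := by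
      simpa using congrArg (fun y => v (algebraMap k K y)) hmn
    exact pow_right_injective₀ (zero_lt_one.trans h) h.ne' h1
  exact not_injective_infinite_finite _ hinj

/-- The homogeneous polynomials of degree `n` that vanish on the center of `v` on `V`.
With `v (coord j)` maximal, `F` vanishes on this center iff
`F (coord / coord j)` is in the maximal ideal of `v`. -/
def vanishing [Finite k] (v : Valuation K ℤᵐ⁰) (n : ℕ) :
    Submodule k (MvPolynomial.homogeneousSubmodule (Fin (V.M + 1)) k n) where
  carrier := {F | v (MvPolynomial.aeval V.coord (F : MvPolynomial (Fin (V.M + 1)) k)) <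
    V.maxVal v ^ n}
  add_mem' := fun {a b} ha hb => by
    simp only [Set.mem_ofPred_eq, Submodule.coe_add, map_add] at *
    exact v.map_add_lt ha hb
  zero_mem' := by
    simpa using pow_pos (V.maxVal_pos v) n
  smul_mem' := fun c F hF => by
    simp only [Set.mem_ofPred_eq, Submodule.coe_smul, map_smul] at *
    rw [Algebra.smul_def, map_mul]
    exact lt_of_le_of_lt (mul_le_of_le_one_left' (val_base_le_one v c)) hF

/-- The Hilbert function of the center of `v` on `V ⊆ ℙ^M`. -/
def hilbert [Finite k] (v : Valuation K ℤᵐ⁰) (n : ℕ) : ℕ :=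
  Module.finrank k
    (MvPolynomial.homogeneousSubmodule (Fin (V.M + 1)) k n ⧸ V.vanishing v n)

/-- The dimension `N` of `V`. -/
def dim (_V : ProjectiveModel k K) : ℕ := Cardinal.toNat (Algebra.trdeg k K)

/-- The projective degree in `ℙ^M` of the divisor of `V` that is the center of `v`. This divisor
has dimension `N - 1`, where `N = dim V`, and its degree is `(N - 1)!` times the leading
coefficient of its Hilbert polynomial, that is the limit of `(N - 1)! H(n) / n ^ (N - 1)`. (The
limit exists; it is written as a `limsup`.) It depends only on the equivalence class of `v`. -/
def deg [Finite k] (v : Valuation K ℤᵐ⁰) : ℝ :=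
  Filter.limsup (fun n : ℕ =>
    ((V.dim - 1).factorial : ℝ) * (V.hilbert v n : ℝ) / (n : ℝ) ^ (V.dim - 1)) Filter.atTop

end ProjectiveModel

/-! ### Local heights -/

/-- The residue degree of the valuation `w` of `L` over its restriction to `K`. -/
def residueDegree (K : Type*) {L : Type*} [Field K] [Field L] [Algebra K L]
    (w : Valuation L ℤᵐ⁰) : ℕ :=
  haveI : (w.comap (algebraMap K L)).HasExtension w := ⟨Valuation.IsEquiv.refl⟩
  Module.finrank (IsLocalRing.ResidueField (w.comap (algebraMap K L)).valuationSubring)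
    (IsLocalRing.ResidueField w.valuationSubring)

/-- `min (0, ord_w y)`, where `w y = exp (-ord_w y)`, and `ord_w 0 = ∞`. -/
def truncOrd {L : Type*} [Field L] (w : Valuation L ℤᵐ⁰) (y : L) : ℤ :=
  min 0 (-(WithZero.log (w y)))

namespace DrinfeldModule

variable {Fq A K : Type*} [Field Fq] [Finite Fq] [CommRing A] [Algebra Fq A]
  [Field K] [Algebra Fq K] {i : A →ₐ[Fq] K} (φ : DrinfeldModule i)

/-- `V_w(x) = lim min (0, ord_w (φ_{a^n} (x))) / deg φ_{a^n}`, computed with the element `a`. -/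
def limitOrd (a : A) {L : Type*} [Field L] [Algebra K L] (w : Valuation L ℤᵐ⁰) (x : L) : ℝ :=
  Filter.limUnder Filter.atTop fun n : ℕ =>
    (truncOrd w ((φ.toRingHom (a ^ n)).eval x) : ℝ) / ((φ.toRingHom (a ^ n)).deg : ℝ)

/-- The local height `ĥ_w(x) = - deg(v) f(w|v) / [L : K] * V_w(x)` for a finite extension `L` of
`K`, a place `w` of `L` in `M_L`, where `v` in `M_K` is the place below `w`, and `x` in `L`,
with `V_w` computed with a nonconstant `a`. -/
def localHeight {k : Type*} [Field k] [Finite k] [Algebra k K]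
    (V : ProjectiveModel k K) (a : A) {L : Type*} [Field L] [Algebra K L]
    (w : Valuation L ℤᵐ⁰) (x : L) : ℝ :=
  -(V.deg (w.comap (algebraMap K L)) * residueDegree K w / Module.finrank K L) *
    φ.limitOrd a w x

end DrinfeldModule

end

noncomputable section

universe uL

/-! ### Newton functions of additive polynomials -/

/-! Some `t ≠ 0` lies in the kernel of `i`. It is nonconstant, and the operator S of `φ_t` has no
linear term (`IsFiniteCharacteristic.exists_transcendental`). Let `q ^ r` be its degree, w a place
of L = K(x), `α i` the orders of the coefficients of S at w, and c a bound for their absolute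
values. Since every exponent in S is at least q, the Newton function f of S, which predicts the
order of S y from that of y, is injective on ℤ and stretches distances by a factor at least q. Below
order -2c the leading term alone decides the order, which then tends to -∞ at a known rate. So a
lower bound for -V_w(x) only needs a bound on the number of steps after which the orbit of x leaves
the ball of order ≥ -2c.

The heart is that this number is O(log c), although cancellation may push the orbit back up
repeatedly (`HasUnboundedOrbit.exists_notMem_orderBall`). Instead of following one orbit, consider
the spaces E_n spanned over the finite field by x, S x, ..., S^(n-1) x. If the orbit of x is
unbounded, so is that of g(S) x for every polynomial g ≠ 0 (`HasUnboundedOrbit.aeval`); hence dim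
E_n = n, and E_n meets no S-stable ball. Filter E_n by order. On graded pieces S maps order u to
order f(u), with a kernel only at the finitely many break points of f, and there of dimension at
most r, because the residue classes in it are roots of a polynomial of degree at most `q ^ r`. An
order with f(u) ≥ u gives a stable ball, so its piece vanishes; an order with f(u) < u falls below
-2c in T steps, once `q ^ T` exceeds `2 c q ^ r`. If the orbit stayed in the ball too long, the
pieces down there would vanish as well, so all of E_N would be used up by the kernels met in T
steps. As f is injective, each step accounts for at most r times the number of break points, and N =
dim E_N would be at most T times a constant (`finrank_le_of_orbit_mem_orderBall`).

It remains to make the constants uniform. On K, w is a ramification index e ≤ [L : K] times the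
valuation of a prime divisor of V, and a given element of K has order bounded over all prime
divisors; so c can be a constant times d (`ProjectiveModel.exists_log_le_mul_finrank`). Then `q ^ T`
is linear in d, and `limitOrd_le_of_neg` bounds -V_w(x) below by a power of 1/d. In the height, the
residue degree is at least 1, [L : K] costs one more power of d, and nonzero degrees of divisors are
bounded below through their Hilbert functions (`ProjectiveModel.le_deg_of_ne_zero`). -/

/-- The Newton function `u ↦ min (α i + q ^ i u)` of an additive polynomial whose coefficients
have orders `α i`. -/
def newtonMin (q : ℕ) {I : Finset ℕ} (hI : I.Nonempty) (α : ℕ → ℤ) (u : ℤ) : ℤ :=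
  I.inf' hI fun i => α i + (q : ℤ) ^ i * u

/-- A finite set containing the integers at which the minimum defining the Newton function is
attained twice. -/
def newtonSlopes (q : ℕ) (I : Finset ℕ) (α : ℕ → ℤ) : Finset ℤ :=
  I.offDiag.image fun p => (α p.1 - α p.2) / ((q : ℤ) ^ p.2 - (q : ℤ) ^ p.1)

section Newton

variable {q : ℕ} {I : Finset ℕ} {hI : I.Nonempty} {α : ℕ → ℤ}

lemma newtonMin_le {i : ℕ} (hi : i ∈ I) (u : ℤ) : newtonMin q hI α u ≤ α i + (q : ℤ) ^ i * u :=
  Finset.inf'_le _ hi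

lemma exists_newtonMin_eq (u : ℤ) : ∃ i ∈ I, newtonMin q hI α u = α i + (q : ℤ) ^ i * u :=
  Finset.exists_mem_eq_inf' hI _

lemma card_newtonSlopes_le : (newtonSlopes q I α).card ≤ I.card * I.card :=
  Finset.card_image_le.trans <| by
    rw [Finset.offDiag_card]; omega

lemma mem_newtonSlopes (hq : 2 ≤ q) {i j : ℕ} (hi : i ∈ I) (hj : j ∈ I) (hij : i ≠ j) {u : ℤ}
    (h : α i + (q : ℤ) ^ i * u = α j + (q : ℤ) ^ j * u) : u ∈ newtonSlopes q I α := by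
  refine Finset.mem_image.mpr ⟨(i, j), Finset.mem_offDiag.mpr ⟨hi, hj, hij⟩, ?_⟩
  have hne : (q : ℤ) ^ j - (q : ℤ) ^ i ≠ 0 := by
    rw [sub_ne_zero]
    exact_mod_cast fun h => hij (Nat.pow_right_injective hq h).symm
  refine Int.ediv_eq_of_eq_mul_left hne ?_
  linear_combination h

/-- Inseparability enters here: without the exponent 0, every line in the minimum has slope at least
q. -/
lemma mul_sub_le_newtonMin_sub (hq : 2 ≤ q) (h0 : 0 ∉ I) {u u' : ℤ} (h : u' ≤ u) :
    (q : ℤ) * (u - u') ≤ newtonMin q hI α u - newtonMin q hI α u' := by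
  obtain ⟨i, hi, hiu⟩ := exists_newtonMin_eq (q := q) (hI := hI) (α := α) u
  have h1 := newtonMin_le (q := q) (hI := hI) (α := α) hi u'
  have hi0 : i ≠ 0 := fun h => h0 (h ▸ hi)
  have h2 : (q : ℤ) ≤ (q : ℤ) ^ i := le_self_pow₀ (by exact_mod_cast (by omega : 1 ≤ q)) hi0
  have h3 := mul_le_mul_of_nonneg_right h2 (sub_nonneg.mpr h)
  rw [hiu]
  linarith

lemma newtonMin_strictMono (hq : 2 ≤ q) (h0 : 0 ∉ I) : StrictMono (newtonMin q hI α) := by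
  intro u' u h
  have h1 := mul_sub_le_newtonMin_sub (hI := hI) (α := α) hq h0 h.le
  have h2 : 0 < (q : ℤ) * (u - u') := mul_pos (by exact_mod_cast (by omega)) (sub_pos.mpr h)
  linarith

/-- The first descent is at least 1, being an integer, and each further application multiplies the
descent by at least q. -/
lemma pow_le_newtonMin_iterate_sub (hq : 2 ≤ q) (h0 : 0 ∉ I) {u : ℤ} (hu : newtonMin q hI α u < u)
    (j : ℕ) : (q : ℤ) ^ j ≤ (newtonMin q hI α)^[j] u - newtonMin q hI α ((newtonMin q hI α)^[j] u) := by
  induction j with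
  | zero => simp only [pow_zero, Function.iterate_zero, id]; omega
  | succ j ih =>
    rw [Function.iterate_succ_apply']
    set v := (newtonMin q hI α)^[j] u
    have hv : newtonMin q hI α v ≤ v := by
      have : (0 : ℤ) ≤ (q : ℤ) ^ j := by positivity
      linarith
    have h1 := mul_sub_le_newtonMin_sub (hI := hI) (α := α) hq h0 hv
    have h2 := mul_le_mul_of_nonneg_left ih (Int.natCast_nonneg q)
    rw [pow_succ, mul_comm]
    linarith

lemma sub_newtonMin_le (hq : 2 ≤ q) {r : ℕ} (hr : ∀ i ∈ I, i ≤ r) {c : ℕ} (hc : ∀ i ∈ I, |α i| ≤ c)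
    {v : ℤ} (hv : -(2 * c) ≤ v) : v - newtonMin q hI α v ≤ 2 * c * q ^ r := by
  obtain ⟨i, hi, hiv⟩ := exists_newtonMin_eq (q := q) (hI := hI) (α := α) v
  have h1 := (abs_le.mp (hc i hi)).1
  have hq1 : (1 : ℤ) ≤ q := by exact_mod_cast (by omega : 1 ≤ q)
  have h2 : (q : ℤ) ^ i ≤ (q : ℤ) ^ r := pow_le_pow_right₀ hq1 (hr i hi)
  have h3 : (1 : ℤ) ≤ (q : ℤ) ^ i := one_le_pow₀ hq1
  have h4 := mul_le_mul_of_nonneg_left hv (sub_nonneg.mpr h3)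
  have h5 := mul_le_mul_of_nonneg_left h2 (by positivity : (0 : ℤ) ≤ 2 * c)
  rw [hiv]
  nlinarith

/-- A point at or above -2c descends by at most `2 c q ^ r`, whereas after T steps the descent is at
least `q ^ T`. -/
lemma newtonMin_iterate_lt (hq : 2 ≤ q) (h0 : 0 ∉ I) {r : ℕ} (hr : ∀ i ∈ I, i ≤ r) {c : ℕ}
    (hc : ∀ i ∈ I, |α i| ≤ c) {T : ℕ} (hT : 2 * c * q ^ r < q ^ T) {u : ℤ}
    (hu : newtonMin q hI α u < u) : (newtonMin q hI α)^[T] u < -(2 * c) := by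
  by_contra! h
  have h1 := sub_newtonMin_le (hI := hI) hq hr hc h
  have h2 := pow_le_newtonMin_iterate_sub hq h0 hu T
  have h3 : (2 * c * q ^ r : ℤ) < q ^ T := by exact_mod_cast hT
  linarith

lemma le_newtonMin (hq : 2 ≤ q) (h0 : 0 ∉ I) {c : ℕ} (hc : ∀ i ∈ I, |α i| ≤ c) {u : ℤ}
    (hu : c ≤ u) : u ≤ newtonMin q hI α u := by
  obtain ⟨i, hi, hiv⟩ := exists_newtonMin_eq (q := q) (hI := hI) (α := α) u
  have h1 := (abs_le.mp (hc i hi)).1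
  have hi0 : i ≠ 0 := fun h => h0 (h ▸ hi)
  have h2 : (q : ℤ) ≤ (q : ℤ) ^ i := le_self_pow₀ (by exact_mod_cast (by omega : 1 ≤ q)) hi0
  have h3 : (2 : ℤ) ≤ q := by exact_mod_cast hq
  rw [hiv]
  nlinarith

end Newton

/-! ### Additive polynomials acting on a valued field -/

section Valued

variable {k L : Type*} [Field k] [Finite k] [Field L] [Algebra k L] (w : Valuation L ℤᵐ⁰)

lemma Valuation.algebraMap_le_one_of_finite (c : k) : w (algebraMap k L c) ≤ 1 := by
  by_contra! h
  have hinj : Function.Injective fun n : ℕ => c ^ n := by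
    intro m n hmn
    have h1 : w (algebraMap k L c) ^ m = w (algebraMap k L c) ^ n := by
      simpa using congrArg (fun y => w (algebraMap k L y)) hmn
    exact pow_right_injective₀ (zero_lt_one.trans h) h.ne' h1
  exact not_injective_infinite_finite _ hinj

lemma Valuation.algebraMap_eq_one_of_finite {c : k} (hc : c ≠ 0) : w (algebraMap k L c) = 1 := by
  refine le_antisymm (w.algebraMap_le_one_of_finite c) ?_
  have h := w.algebraMap_le_one_of_finite c⁻¹
  rw [map_inv₀, map_inv₀] at h
  have h0 : 0 < w (algebraMap k L c) := by
    simpa [zero_lt_iff] using hc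
  exact (inv_le_one₀ h0).mp h

variable (k) in
/-- The `k`-subspace of elements of order at least `u`. -/
def orderBall (u : ℤ) : Submodule k L where
  carrier := {y | w y ≤ WithZero.exp (-u)}
  add_mem' := fun ha hb => w.map_add_le ha hb
  zero_mem' := by simp
  smul_mem' := fun c _ hy => by
    simp only [Set.mem_ofPred_eq] at *
    rw [Algebra.smul_def, map_mul]
    exact (mul_le_of_le_one_left' (w.algebraMap_le_one_of_finite c)).trans hy

variable {w}

lemma mem_orderBall {u : ℤ} {y : L} : y ∈ orderBall k w u ↔ w y ≤ WithZero.exp (-u) := Iff.rfl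

lemma orderBall_anti {u u' : ℤ} (h : u' ≤ u) : orderBall k w u ≤ orderBall k w u' := fun y hy =>
  (mem_orderBall.mp hy).trans (WithZero.exp_le_exp.mpr (neg_le_neg h))

lemma notMem_orderBall_iff {u : ℤ} {y : L} :
    y ∉ orderBall k w (u + 1) ↔ WithZero.exp (-u) ≤ w y := by
  rw [mem_orderBall, not_le]
  rcases eq_or_ne (w y) 0 with h | h
  · simp [h]
  · rw [← WithZero.exp_log h]
    simp only [WithZero.exp_lt_exp, WithZero.exp_le_exp]
    omega

lemma eq_exp_of_mem_of_notMem {u : ℤ} {y : L} (h : y ∈ orderBall k w u)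
    (h' : y ∉ orderBall k w (u + 1)) : w y = WithZero.exp (-u) :=
  le_antisymm h (notMem_orderBall_iff.mp h')

lemma exists_eq_exp_of_notMem {u : ℤ} {y : L} (h : y ∉ orderBall k w u) :
    ∃ v < u, w y = WithZero.exp (-v) := by
  have h1 := notMem_orderBall_iff.mp (by simpa using h : y ∉ orderBall k w (u - 1 + 1))
  have h0 : w y ≠ 0 := (WithZero.exp_pos.trans_le h1).ne'
  refine ⟨-WithZero.log (w y), ?_, by simp [WithZero.exp_log h0]⟩
  rw [← WithZero.exp_log h0, WithZero.exp_le_exp] at h1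
  omega

variable {I : Finset ℕ} {hI : I.Nonempty} {α : ℕ → ℤ} {a : ℕ → L} {S : L →ₗ[k] L}

lemma val_monomial {q i : ℕ} {a y : L} {α u : ℤ} (ha : w a = WithZero.exp (-α))
    (hy : w y = WithZero.exp (-u)) :
    w (a * y ^ q ^ i) = WithZero.exp (-(α + (q : ℤ) ^ i * u)) := by
  rw [map_mul, map_pow, ha, hy, ← WithZero.exp_nsmul, ← WithZero.exp_add]
  congr 1
  simp; ring

lemma val_monomial_le {q i : ℕ} {a y : L} {α u : ℤ} (ha : w a = WithZero.exp (-α))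
    (hy : w y ≤ WithZero.exp (-u)) :
    w (a * y ^ q ^ i) ≤ WithZero.exp (-(α + (q : ℤ) ^ i * u)) := by
  rw [map_mul, map_pow, ha]
  refine (mul_le_mul_right (pow_le_pow_left₀ zero_le hy _) _).trans (le_of_eq ?_)
  rw [← WithZero.exp_nsmul, ← WithZero.exp_add]
  congr 1
  simp; ring

lemma map_mem_orderBall (hS : ∀ y, S y = ∑ i ∈ I, a i * y ^ Nat.card k ^ i)
    (hα : ∀ i ∈ I, w (a i) = WithZero.exp (-α i)) {u : ℤ} {y : L} (hy : y ∈ orderBall k w u) :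
    S y ∈ orderBall k w (newtonMin (Nat.card k) hI α u) := by
  rw [mem_orderBall, hS]
  refine w.map_sum_le fun i hi => (val_monomial_le (hα i hi) hy).trans ?_
  exact WithZero.exp_le_exp.mpr (neg_le_neg (newtonMin_le hi u))

/-- Away from the break points the minimum is attained by one monomial only, which dominates the
others ultrametrically. -/
lemma val_map_eq_of_notMem_slopes (hS : ∀ y, S y = ∑ i ∈ I, a i * y ^ Nat.card k ^ i)
    (hα : ∀ i ∈ I, w (a i) = WithZero.exp (-α i)) {u : ℤ} (hu : u ∉ newtonSlopes (Nat.card k) I α)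
    {y : L} (hy : w y = WithZero.exp (-u)) :
    w (S y) = WithZero.exp (-newtonMin (Nat.card k) hI α u) := by
  have hq : 2 ≤ Nat.card k := Finite.one_lt_card
  obtain ⟨j, hj, hju⟩ := exists_newtonMin_eq (q := Nat.card k) (hI := hI) (α := α) u
  rw [hS, hju, ← val_monomial (hα j hj) hy]
  refine w.map_sum_eq_of_lt hj fun i hi => ?_
  obtain ⟨hi, hij⟩ := Finset.mem_sdiff.mp hi
  rw [Finset.mem_singleton] at hij
  rw [val_monomial (hα j hj) hy, val_monomial (hα i hi) hy, WithZero.exp_lt_exp, neg_lt_neg_iff]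
  refine lt_of_le_of_ne (hju ▸ newtonMin_le hi u) fun h => hu ?_
  exact mem_newtonSlopes hq hj hi (Ne.symm hij) h

end Valued

/-! ### Graded pieces of the filtration by order, and the kernel of S on them -/

section Kernel

lemma Submodule.finrank_map_add_finrank_inf_ker {k V W : Type*} [Field k] [AddCommGroup V] [Module k V]
    [AddCommGroup W] [Module k W] (G : Submodule k V) [FiniteDimensional k G] (f : V →ₗ[k] W) :
    Module.finrank k (G.map f) + Module.finrank k (G ⊓ LinearMap.ker f : Submodule k V) =
      Module.finrank k G := by
  rw [← (f.domRestrict G).finrank_range_add_finrank_ker]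
  congr 1
  · rw [LinearMap.range_domRestrict]
  · rw [LinearMap.ker_domRestrict, ← Submodule.map_comap_subtype]
    exact (Submodule.equivMapOfInjective _ G.injective_subtype _).finrank_eq.symm

variable {k L : Type*} [Field k] [Finite k] [Field L] [Algebra k L] {w : Valuation L ℤᵐ⁰}
  {I : Finset ℕ} {hI : I.Nonempty} {α : ℕ → ℤ} {a : ℕ → L} {S : L →ₗ[k] L}

/-- The residue classes, relative to a fixed element of order `u`, of the elements of order `u`
that an additive polynomial maps to larger order than expected are the roots of a polynomial of
degree at most `q ^ r`. -/
lemma finrank_map_mkQ_le_of_mem_slopes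
    (hS : ∀ y, S y = ∑ i ∈ I, a i * y ^ Nat.card k ^ i)
    (hα : ∀ i ∈ I, w (a i) = WithZero.exp (-α i)) {r : ℕ} (hr : ∀ i ∈ I, i ≤ r) {u : ℤ}
    (G : Submodule k L) [FiniteDimensional k G] (hG : G ≤ orderBall k w u)
    (hGS : ∀ y ∈ G, S y ∈ orderBall k w (newtonMin (Nat.card k) hI α u + 1)) :
    Module.finrank k (G.map (orderBall k w (u + 1)).mkQ) ≤ r := by
  by_cases hc : ∀ y ∈ G, y ∈ orderBall k w (u + 1)
  · have : G.map (orderBall k w (u + 1)).mkQ = ⊥ := by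
      rw [eq_bot_iff, Submodule.map_le_iff_le_comap]
      intro y hy
      simpa using hc y hy
    rw [this]
    simp
  push Not at hc
  obtain ⟨c, hcG, hcu⟩ := hc
  have hwc : w c = WithZero.exp (-u) := eq_exp_of_mem_of_notMem (hG hcG) hcu
  have hwc0 : w c ≠ 0 := by rw [hwc]; exact WithZero.exp_ne_zero
  have hc0 : c ≠ 0 := (Valuation.ne_zero_iff w).mp hwc0
  obtain ⟨j, hj, hju⟩ := exists_newtonMin_eq (q := Nat.card k) (hI := hI) (α := α) u
  -- The polynomial S(cX)/b has integral coefficients, and the one at `q ^ j` is 1. Its reduction P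
  -- is therefore nonzero, and the classes of y/c for y in G are roots of P.
  set b := a j * c ^ Nat.card k ^ j with hb
  have hwb : w b = WithZero.exp (-newtonMin (Nat.card k) hI α u) := by
    rw [hju]; exact val_monomial (hα j hj) hwc
  have hwb0 : w b ≠ 0 := by rw [hwb]; exact WithZero.exp_ne_zero
  have hb0 : b ≠ 0 := (Valuation.ne_zero_iff w).mp hwb0
  classical
  let O := w.valuationSubring
  have hcoef : ∀ i, i ∈ I → a i * c ^ Nat.card k ^ i / b ∈ O := fun i hi => by
    rw [Valuation.mem_valuationSubring_iff, map_div₀, val_monomial (hα i hi) hwc, hwb,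
      div_le_one₀ WithZero.exp_pos, WithZero.exp_le_exp, neg_le_neg_iff]
    exact newtonMin_le hi u
  let co : ℕ → O := fun i => if hi : i ∈ I then ⟨_, hcoef i hi⟩ else 0
  let P : Polynomial (IsLocalRing.ResidueField O) :=
    ∑ i ∈ I, Polynomial.C (IsLocalRing.residue O (co i)) * Polynomial.X ^ Nat.card k ^ i
  have hinj : Function.Injective fun i : ℕ => Nat.card k ^ i :=
    Nat.pow_right_injective Finite.one_lt_card
  have hP0 : P ≠ 0 := by
    intro h
    have h1 : P.coeff (Nat.card k ^ j) = 1 := by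
      simp only [P, Polynomial.finsetSum_coeff, Polynomial.coeff_C_mul_X_pow]
      rw [Finset.sum_eq_single_of_mem j hj]
      · simp only [if_true, co, dif_pos hj]
        rw [← map_one (IsLocalRing.residue O)]
        congr 1
        exact Subtype.ext (div_self hb0)
      · intro i _ hij
        rw [if_neg fun h => hij (hinj h).symm]
    rw [h] at h1
    simp at h1
  have hPdeg : P.natDegree ≤ Nat.card k ^ r := by
    refine Polynomial.natDegree_sum_le_of_forall_le _ _ fun i hi => ?_
    exact (Polynomial.natDegree_C_mul_X_pow_le _ _).trans (Nat.pow_le_pow_right Nat.card_pos (hr i hi))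
  have hdiv : ∀ y ∈ G, y / c ∈ O := fun y hy => by
    rw [Valuation.mem_valuationSubring_iff, map_div₀, hwc, div_le_one₀ WithZero.exp_pos]
    exact hG hy
  let ρ : G → IsLocalRing.ResidueField O := fun y => IsLocalRing.residue O ⟨_, hdiv y y.2⟩
  have hroot : ∀ y : G, ρ y ∈ P.roots.toFinset := fun y => by
    rw [Multiset.mem_toFinset, Polynomial.mem_roots hP0, Polynomial.IsRoot]
    have : P.eval (ρ y) = IsLocalRing.residue O
        (∑ i ∈ I, co i * ⟨_, hdiv y y.2⟩ ^ Nat.card k ^ i) := by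
      simp only [P, ρ, Polynomial.eval_finsetSum, map_sum, map_mul, map_pow, Polynomial.eval_mul,
        Polynomial.eval_C, Polynomial.eval_pow, Polynomial.eval_X]
    have hval : ((∑ i ∈ I, co i * (⟨_, hdiv y y.2⟩ : O) ^ Nat.card k ^ i : O) : L) = S y / b := by
      rw [hS, Finset.sum_div, AddSubmonoidClass.coe_finsetSum]
      refine Finset.sum_congr rfl fun i hi => ?_
      simp only [co, dif_pos hi, MulMemClass.coe_mul, SubmonoidClass.coe_pow]
      rw [div_pow]
      field_simp
    rw [this, IsLocalRing.residue_eq_zero_iff, Valuation.mem_maximalIdeal_iff, hval, map_div₀, hwb,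
      div_lt_one₀ WithZero.exp_pos]
    exact (mem_orderBall.mp (hGS y y.2)).trans_lt (WithZero.exp_lt_exp.mpr (by omega))
  have hρ : ∀ y z : G, ρ y = ρ z → (y - z : L) ∈ orderBall k w (u + 1) := fun y z h => by
    by_contra hyz
    rw [← sub_eq_zero, ← map_sub, IsLocalRing.residue_eq_zero_iff,
      Valuation.mem_maximalIdeal_iff] at h
    simp only [AddSubgroupClass.coe_sub] at h
    rw [← sub_div, map_div₀, hwc, div_lt_one₀ WithZero.exp_pos] at h
    exact (notMem_orderBall_iff.mp hyz).not_gt h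
  let M := G.map (orderBall k w (u + 1)).mkQ
  have hsurj : ∀ m : M, ∃ y : G, (orderBall k w (u + 1)).mkQ y = m := fun m => by
    obtain ⟨y, hy, hym⟩ := m.2
    exact ⟨⟨y, hy⟩, hym⟩
  choose g hg using hsurj
  have hgi : Function.Injective fun m : M => (⟨ρ (g m), hroot (g m)⟩ : P.roots.toFinset) := by
    intro m m' h
    have h1 := hρ _ _ (congrArg Subtype.val h)
    refine Subtype.ext ?_
    rw [← hg m, ← hg m', ← sub_eq_zero, ← map_sub, Submodule.mkQ_apply,
      Submodule.Quotient.mk_eq_zero]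
    exact h1
  have hcard : Nat.card M ≤ Nat.card k ^ r := by
    refine (Nat.card_le_card_of_injective _ hgi).trans ?_
    rw [Nat.card_eq_fintype_card, Fintype.card_coe]
    exact (Multiset.toFinset_card_le _).trans ((Polynomial.card_roots' P).trans hPdeg)
  rw [Module.natCard_eq_pow_finrank (K := k)] at hcard
  exact (Nat.pow_le_pow_iff_right Finite.one_lt_card).mp hcard

/-- This compares the graded piece of E at u with that of E' at the Newton value of u: rank-nullity
for the map induced by S, written additively to avoid subtraction in ℕ. -/
lemma finrank_inf_orderBall_step
    (hS : ∀ y, S y = ∑ i ∈ I, a i * y ^ Nat.card k ^ i)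
    (hα : ∀ i ∈ I, w (a i) = WithZero.exp (-α i)) {r : ℕ} (hr : ∀ i ∈ I, i ≤ r) (u : ℤ)
    (E E' : Submodule k L) [FiniteDimensional k E] [FiniteDimensional k E']
    (hE : E.map S ≤ E') :
    Module.finrank k (E ⊓ orderBall k w u : Submodule k L) +
      Module.finrank k
        (E' ⊓ orderBall k w (newtonMin (Nat.card k) hI α u + 1) : Submodule k L) ≤
      Module.finrank k (E ⊓ orderBall k w (u + 1) : Submodule k L) +
      Module.finrank k (E' ⊓ orderBall k w (newtonMin (Nat.card k) hI α u) : Submodule k L) +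
      if u ∈ newtonSlopes (Nat.card k) I α then r else 0 := by
  have hanti : ∀ v, orderBall k w (v + 1) ≤ orderBall k w v := fun v => orderBall_anti (by omega)
  set f := newtonMin (Nat.card k) hI α u with hf
  set G := E ⊓ orderBall k w u
  set G' := E' ⊓ orderBall k w f
  have hfinG : FiniteDimensional k G := Submodule.finiteDimensional_inf_left _ _
  have hfinG' : FiniteDimensional k G' := Submodule.finiteDimensional_inf_left _ _
  -- The image of H in the graded piece at u is the kernel of the induced map.
  set H := G ⊓ (orderBall k w (f + 1)).comap S with hH
  have hfinH : FiniteDimensional k H := Submodule.finiteDimensional_inf_left _ _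
  have h1 := Submodule.finrank_map_add_finrank_inf_ker G ((orderBall k w (f + 1)).mkQ ∘ₗ S)
  rw [LinearMap.ker_comp, Submodule.ker_mkQ, ← hH] at h1
  have h2 := Submodule.finrank_map_add_finrank_inf_ker G' (orderBall k w (f + 1)).mkQ
  rw [Submodule.ker_mkQ, inf_assoc, inf_eq_right.mpr (hanti f)] at h2
  have h3 : Module.finrank k (G.map ((orderBall k w (f + 1)).mkQ ∘ₗ S)) ≤
      Module.finrank k (G'.map (orderBall k w (f + 1)).mkQ) := by
    refine Submodule.finrank_mono ?_
    rw [Submodule.map_comp]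
    refine Submodule.map_mono (le_inf ((Submodule.map_mono inf_le_left).trans hE) ?_)
    rintro _ ⟨y, hy, rfl⟩
    exact map_mem_orderBall hS hα hy.2
  have h4 := Submodule.finrank_map_add_finrank_inf_ker H (orderBall k w (u + 1)).mkQ
  rw [Submodule.ker_mkQ] at h4
  have hfinE : FiniteDimensional k (E ⊓ orderBall k w (u + 1) : Submodule k L) :=
    Submodule.finiteDimensional_inf_left _ _
  have h5 : Module.finrank k (H ⊓ orderBall k w (u + 1) : Submodule k L) ≤
      Module.finrank k (E ⊓ orderBall k w (u + 1) : Submodule k L) :=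
    Submodule.finrank_mono (inf_le_inf_right _ (inf_le_left.trans inf_le_left))
  have h6 : Module.finrank k (H.map (orderBall k w (u + 1)).mkQ) ≤
      if u ∈ newtonSlopes (Nat.card k) I α then r else 0 := by
    split_ifs with hu
    · exact finrank_map_mkQ_le_of_mem_slopes hS hα hr H (inf_le_left.trans inf_le_right)
        (fun y hy => hy.2)
    · have : H.map (orderBall k w (u + 1)).mkQ = ⊥ := by
        rw [eq_bot_iff, Submodule.map_le_iff_le_comap]
        intro y hy
        by_contra hyu
        have hyu' : y ∉ orderBall k w (u + 1) := by simpa using hyu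
        have hwy := eq_exp_of_mem_of_notMem hy.1.2 hyu'
        have h7 := val_map_eq_of_notMem_slopes (hI := hI) hS hα hu hwy
        have h8 : S y ∈ orderBall k w (f + 1) := hy.2
        rw [mem_orderBall, h7, WithZero.exp_le_exp] at h8
        omega
      rw [this]
      simp
  omega

end Kernel

/-! ### Unbounded orbits and the time they need to escape -/

section Orbits

variable {k L : Type*} [Field k] [Finite k] [Field L] [Algebra k L] {w : Valuation L ℤᵐ⁰}
  {I : Finset ℕ} {hI : I.Nonempty} {α : ℕ → ℤ} {a : ℕ → L} {S : L →ₗ[k] L}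

/-- Every nonzero element of a graded piece of E N has to die under S within T steps, and it can die
only at a break point. Injectivity of the Newton function keeps a break point from being counted
twice at the same step. -/
lemma finrank_le_of_orbit_mem_orderBall
    (hS : ∀ y, S y = ∑ i ∈ I, a i * y ^ Nat.card k ^ i)
    (hα : ∀ i ∈ I, w (a i) = WithZero.exp (-α i)) (h0 : 0 ∉ I) {r : ℕ} (hr : ∀ i ∈ I, i ≤ r)
    {c : ℕ} (hc : ∀ i ∈ I, |α i| ≤ c) {T : ℕ} (hT : 2 * c * Nat.card k ^ r < Nat.card k ^ T)
    (E : ℕ → Submodule k L) [∀ n, FiniteDimensional k (E n)] (hmono : Monotone E)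
    (hE : ∀ n, (E n).map S ≤ E (n + 1))
    (hbot : ∀ n u, u ≤ newtonMin (Nat.card k) hI α u → E n ⊓ orderBall k w u = ⊥) {N : ℕ}
    (hN : E (N + T) ≤ orderBall k w (-(2 * c))) :
    Module.finrank k (E N) ≤ T * ((newtonSlopes (Nat.card k) I α).card * r) := by
  have hq : 2 ≤ Nat.card k := Finite.one_lt_card
  set f := newtonMin (Nat.card k) hI α with hf
  set P := newtonSlopes (Nat.card k) I α with hP
  -- D n u is the dimension of the graded piece of E n at order u, and ρ bounds the kernel of S
  -- there.
  let g : ℕ → ℤ → ℤ := fun n u => Module.finrank k (E n ⊓ orderBall k w u : Submodule k L)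
  let D : ℕ → ℤ → ℤ := fun n u => g n u - g n (u + 1)
  let ρ : ℤ → ℤ := fun u => if u ∈ P then r else 0
  have hρ0 : ∀ u, 0 ≤ ρ u := fun u => by simp only [ρ]; split_ifs <;> simp
  have hstep : ∀ n u, D n u ≤ D (n + 1) (f u) + ρ u := fun n u => by
    have h := finrank_inf_orderBall_step (hI := hI) hS hα hr u (E n) (E (n + 1)) (hE n)
    rw [← hf, ← hP] at h
    simp only [D, g, ρ]
    split_ifs at h ⊢ <;> omega
  have hiter : ∀ T n u, D n u ≤ D (n + T) (f^[T] u) + ∑ j ∈ Finset.range T, ρ (f^[j] u) := by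
    intro T
    induction T with
    | zero => intro n u; simp
    | succ T ih =>
      intro n u
      have h1 := ih n u
      have h2 := hstep (n + T) (f^[T] u)
      rw [Finset.sum_range_succ, Function.iterate_succ_apply']
      rw [add_assoc] at h2
      linarith
  -- If f u < u, then T steps lead below -2c, where E (N + T) has no graded piece left; otherwise
  -- the ball at u is stable and meets E N trivially.
  have hD : ∀ u, D N u ≤ ∑ j ∈ Finset.range T, ρ (f^[j] u) := by
    intro u
    by_cases hu : f u < u
    · refine (hiter T N u).trans (le_of_eq ?_)
      have hlt := newtonMin_iterate_lt (hI := hI) hq h0 hr hc hT hu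
      rw [← hf] at hlt
      have h1 : E (N + T) ⊓ orderBall k w (f^[T] u) = E (N + T) :=
        inf_eq_left.mpr (hN.trans (orderBall_anti hlt.le))
      have h2 : E (N + T) ⊓ orderBall k w (f^[T] u + 1) = E (N + T) :=
        inf_eq_left.mpr (hN.trans (orderBall_anti (by omega)))
      simp only [D, g]
      rw [h1, h2]
      ring
    · have h1 : D N u ≤ 0 := by
        simp only [D, g]
        rw [hbot N u (not_lt.mp hu), finrank_bot]
        simp
      exact h1.trans (Finset.sum_nonneg fun j _ => hρ0 _)
  -- All orders in E N lie between -2c and c: from c on the balls are stable. The 3c graded pieces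
  -- in between telescope.
  have htel : (Module.finrank k (E N) : ℤ) =
      ∑ i ∈ Finset.range (3 * c), D N (-(2 * c) + i) := by
    have h1 : E N ⊓ orderBall k w (-(2 * c)) = E N :=
      inf_eq_left.mpr ((hmono (Nat.le_add_right N T)).trans hN)
    have h2 : E N ⊓ orderBall k w c = ⊥ := hbot N c (le_newtonMin hq h0 hc le_rfl)
    have h3 := Finset.sum_range_sub' (fun i : ℕ => g N (-(2 * c) + i)) (3 * c)
    have h4 : (-(2 * c) + ((3 * c : ℕ) : ℤ) : ℤ) = c := by push_cast; ring
    rw [h4] at h3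
    simp only [Nat.cast_zero, add_zero, Nat.cast_add, Nat.cast_one, ← add_assoc] at h3
    simp only [D]
    rw [h3]
    simp only [g]
    rw [h1, h2, finrank_bot]
    simp
  have hcount : ∀ j, ∑ i ∈ Finset.range (3 * c), ρ (f^[j] (-(2 * c) + i)) ≤ P.card * r := by
    intro j
    have hinj : Function.Injective fun i : ℕ => f^[j] (-(2 * c) + i) := by
      intro i i' h
      have := (newtonMin_strictMono (hI := hI) (α := α) hq h0).injective.iterate j h
      simpa using this
    calc ∑ i ∈ Finset.range (3 * c), ρ (f^[j] (-(2 * c) + i))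
        = ∑ u ∈ (Finset.range (3 * c)).image (fun i : ℕ => f^[j] (-(2 * c) + i)), ρ u :=
          (Finset.sum_image hinj.injOn).symm
      _ = ∑ u ∈ (Finset.range (3 * c)).image (fun i : ℕ => f^[j] (-(2 * c) + i)) with u ∈ P,
            (r : ℤ) := (Finset.sum_filter _ _).symm
      _ ≤ ∑ u ∈ P, (r : ℤ) := Finset.sum_le_sum_of_subset_of_nonneg
          (fun u hu => (Finset.mem_filter.mp hu).2) (fun _ _ _ => by positivity)
      _ = P.card * r := by simp
  have : (Module.finrank k (E N) : ℤ) ≤ T * (P.card * r) := by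
    rw [htel]
    refine (Finset.sum_le_sum fun i _ => hD _).trans ?_
    rw [Finset.sum_comm]
    refine (Finset.sum_le_sum fun j _ => hcount j).trans ?_
    simp
  exact_mod_cast this

/-- Two powers of q differ by at least 1, so for u < -2c passing to a lower monomial costs more than
the 2c that the coefficients could make up. -/
lemma val_map_of_notMem_orderBall
    (hS : ∀ y, S y = ∑ i ∈ I, a i * y ^ Nat.card k ^ i)
    (hα : ∀ i ∈ I, w (a i) = WithZero.exp (-α i)) {r : ℕ} (hrI : r ∈ I)
    (hr : ∀ i ∈ I, i ≤ r) {c : ℕ} (hc : ∀ i ∈ I, |α i| ≤ c) {u : ℤ} (hu : u < -(2 * c)) {y : L}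
    (hy : w y = WithZero.exp (-u)) :
    w (S y) = WithZero.exp (-(α r + (Nat.card k : ℤ) ^ r * u)) := by
  have hq : 2 ≤ Nat.card k := Finite.one_lt_card
  rw [hS, ← val_monomial (hα r hrI) hy]
  refine w.map_sum_eq_of_lt hrI fun i hi => ?_
  obtain ⟨hi, hir⟩ := Finset.mem_sdiff.mp hi
  rw [Finset.mem_singleton] at hir
  rw [val_monomial (hα r hrI) hy, val_monomial (hα i hi) hy, WithZero.exp_lt_exp, neg_lt_neg_iff]
  have h1 : (Nat.card k : ℤ) ^ i + 1 ≤ (Nat.card k : ℤ) ^ r := by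
    exact_mod_cast Nat.pow_lt_pow_right hq (lt_of_le_of_ne (hr i hi) hir)
  have h2 := abs_le.mp (hc r hrI)
  have h3 := abs_le.mp (hc i hi)
  nlinarith

lemma map_notMem_orderBall_sub_one
    (hS : ∀ y, S y = ∑ i ∈ I, a i * y ^ Nat.card k ^ i)
    (hα : ∀ i ∈ I, w (a i) = WithZero.exp (-α i)) (h0 : 0 ∉ I) {r : ℕ} (hrI : r ∈ I)
    (hr : ∀ i ∈ I, i ≤ r) {c : ℕ} (hc : ∀ i ∈ I, |α i| ≤ c) {v : ℤ} (hv : v ≤ -(2 * c)) {y : L}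
    (hy : y ∉ orderBall k w v) : S y ∉ orderBall k w (v - 1) ∧ w y < w (S y) := by
  have hq : 2 ≤ Nat.card k := Finite.one_lt_card
  obtain ⟨u, hu, hyu⟩ := exists_eq_exp_of_notMem hy
  have h := val_map_of_notMem_orderBall hS hα hrI hr hc (hu.trans_le hv) hyu
  have hr0 : r ≠ 0 := fun h => h0 (h ▸ hrI)
  have h1 : (Nat.card k : ℤ) ≤ (Nat.card k : ℤ) ^ r :=
    le_self_pow₀ (by exact_mod_cast (by omega : 1 ≤ Nat.card k)) hr0
  have h2 := abs_le.mp (hc r hrI)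
  have h3 : (2 : ℤ) ≤ Nat.card k := by exact_mod_cast hq
  have h4 : α r + (Nat.card k : ℤ) ^ r * u < u := by nlinarith
  constructor
  · rw [mem_orderBall, h, WithZero.exp_le_exp]
    omega
  · rw [h, hyu, WithZero.exp_lt_exp]
    omega

variable (k w S) in
/-- The orbit of `x` under `S` is unbounded for the valuation `w`. -/
def HasUnboundedOrbit (x : L) : Prop := ∀ u : ℤ, ∃ n : ℕ, (S ^ n) x ∉ orderBall k w u

/-- The ball at u is stable under S. -/
lemma not_hasUnboundedOrbit_of_mem
    (hS : ∀ y, S y = ∑ i ∈ I, a i * y ^ Nat.card k ^ i)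
    (hα : ∀ i ∈ I, w (a i) = WithZero.exp (-α i)) {u : ℤ}
    (hu : u ≤ newtonMin (Nat.card k) hI α u) {x : L} (hx : x ∈ orderBall k w u) :
    ¬ HasUnboundedOrbit k w S x := by
  intro h
  obtain ⟨n, hn⟩ := h u
  refine hn ?_
  clear hn
  induction n with
  | zero => exact hx
  | succ n ih =>
    rw [pow_succ']
    exact orderBall_anti hu (map_mem_orderBall hS hα ih)

/-- Once the orbit has left the ball at -2c, its values increase strictly. Nonzero constants have
value 1, so the term of top degree of g(S) x dominates from then on. -/
lemma HasUnboundedOrbit.aeval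
    (hS : ∀ y, S y = ∑ i ∈ I, a i * y ^ Nat.card k ^ i)
    (hα : ∀ i ∈ I, w (a i) = WithZero.exp (-α i)) (h0 : 0 ∉ I) {r : ℕ} (hrI : r ∈ I)
    (hr : ∀ i ∈ I, i ≤ r) {c : ℕ} (hc : ∀ i ∈ I, |α i| ≤ c) {x : L}
    (hx : HasUnboundedOrbit k w S x) {g : Polynomial k} (hg : g ≠ 0) :
    HasUnboundedOrbit k w S (Polynomial.aeval S g x) := by
  obtain ⟨n₀, hn₀⟩ := hx (-(2 * c))
  have hgrow : ∀ j : ℕ, (S ^ (n₀ + j)) x ∉ orderBall k w (-(2 * c) - j) := by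
    intro j
    induction j with
    | zero => simpa using hn₀
    | succ j ih =>
      rw [← add_assoc, pow_succ']
      have h := (map_notMem_orderBall_sub_one hS hα h0 hrI hr hc (by omega) ih).1
      have e : (-(2 * c) - (j + 1 : ℕ) : ℤ) = -(2 * c) - j - 1 := by push_cast; ring
      rw [e]
      exact h
  have hmono : StrictMono fun j : ℕ => w ((S ^ (n₀ + j)) x) := by
    refine strictMono_nat_of_lt_succ fun j => ?_
    rw [← add_assoc, pow_succ' S (n₀ + j)]
    exact (map_notMem_orderBall_sub_one hS hα h0 hrI hr hc (by omega) (hgrow j)).2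
  intro u
  refine ⟨n₀ + (-(2 * c) - u).toNat, ?_⟩
  set j := (-(2 * c) - u).toNat
  have h1 : (S ^ (n₀ + j)) (Polynomial.aeval S g x) =
      ∑ i ∈ Finset.range (g.natDegree + 1), g.coeff i • (S ^ (n₀ + (j + i))) x := by
    rw [Polynomial.aeval_eq_sum_range, LinearMap.sum_apply, map_sum]
    refine Finset.sum_congr rfl fun i _ => ?_
    rw [LinearMap.smul_apply, map_smul, ← Module.End.mul_apply, ← pow_add, add_assoc]
  have hval : ∀ i, g.coeff i ≠ 0 → w (g.coeff i • (S ^ (n₀ + (j + i))) x) =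
      w ((S ^ (n₀ + (j + i))) x) := fun i hi => by
    rw [Algebra.smul_def, map_mul, w.algebraMap_eq_one_of_finite hi, one_mul]
  have hlead : g.coeff g.natDegree ≠ 0 := by simpa using hg
  have h2 : w ((S ^ (n₀ + j)) (Polynomial.aeval S g x)) =
      w ((S ^ (n₀ + (j + g.natDegree))) x) := by
    rw [h1, ← hval _ hlead]
    refine w.map_sum_eq_of_lt (Finset.self_mem_range_succ _) fun i hi => ?_
    obtain ⟨hi, hig⟩ := Finset.mem_sdiff.mp hi
    rw [Finset.mem_singleton] at hig
    have hlt : i < g.natDegree := by have := Finset.mem_range.mp hi; omega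
    rw [hval _ hlead]
    by_cases hgi : g.coeff i = 0
    · rw [hgi, zero_smul, map_zero]
      exact zero_le.trans_lt (hmono (show j + i < j + g.natDegree by omega))
    · rw [hval _ hgi]
      exact hmono (show j + i < j + g.natDegree by omega)
  rw [mem_orderBall, h2]
  exact fun h => hgrow (j + g.natDegree) (orderBall_anti (by omega) h)

/-- The key estimate: an unbounded orbit leaves the ball of radius `2 c` after a number of steps
that is logarithmic in `c`. -/
theorem HasUnboundedOrbit.exists_notMem_orderBall
    (hS : ∀ y, S y = ∑ i ∈ I, a i * y ^ Nat.card k ^ i)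
    (hα : ∀ i ∈ I, w (a i) = WithZero.exp (-α i)) (h0 : 0 ∉ I) {r : ℕ} (hrI : r ∈ I)
    (hr : ∀ i ∈ I, i ≤ r) {c : ℕ} (hc : ∀ i ∈ I, |α i| ≤ c) {T : ℕ}
    (hT : 2 * c * Nat.card k ^ r < Nat.card k ^ T) {x : L} (hx : HasUnboundedOrbit k w S x) :
    ∃ n ≤ T * (I.card * I.card * r + 1), (S ^ n) x ∉ orderBall k w (-(2 * c)) := by
  have hI : I.Nonempty := ⟨r, hrI⟩
  by_contra! hcon
  -- The map g ↦ g(S) x is injective, because nonzero g give unbounded orbits; so E n, the image of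
  -- the polynomials of degree < n, has dimension exactly n.
  let ev : Polynomial k →ₗ[k] L :=
    (LinearMap.applyₗ x).comp (Polynomial.aeval (R := k) S).toLinearMap
  have hev : ∀ g, ev g = Polynomial.aeval S g x := fun g => rfl
  have hne : ∀ g, g ≠ 0 → HasUnboundedOrbit k w S (ev g) := fun g hg =>
    hx.aeval hS hα h0 hrI hr hc hg
  have hinj : Function.Injective ev := by
    rw [← LinearMap.ker_eq_bot, LinearMap.ker_eq_bot']
    intro g hg
    by_contra hg0
    obtain ⟨n, hn⟩ := hne g hg0 0
    rw [hg, map_zero] at hn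
    exact hn (zero_mem _)
  let E : ℕ → Submodule k L := fun n => (Polynomial.degreeLT k n).map ev
  have hfd : ∀ n, FiniteDimensional k (Polynomial.degreeLT k n) := fun n =>
    (Polynomial.degreeLTEquiv k n).symm.finiteDimensional
  have hfin : ∀ n, FiniteDimensional k (E n) := fun n => inferInstance
  have hrank : ∀ n, Module.finrank k (E n) = n := fun n => by
    rw [← (Submodule.equivMapOfInjective ev hinj _).finrank_eq,
      (Polynomial.degreeLTEquiv k n).finrank_eq, Module.finrank_fin_fun]
  have hmono : Monotone E := fun m n hmn => Submodule.map_mono (Polynomial.degreeLT_mono hmn)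
  have hES : ∀ n, (E n).map S ≤ E (n + 1) := by
    rintro n _ ⟨_, ⟨g, hg, rfl⟩, rfl⟩
    refine ⟨Polynomial.X * g, ?_, ?_⟩
    · rw [SetLike.mem_coe, Polynomial.mem_degreeLT] at hg ⊢
      rcases eq_or_ne g 0 with rfl | hg0
      · simp
      rw [Polynomial.degree_eq_natDegree hg0, Nat.cast_lt] at hg
      rw [Polynomial.degree_eq_natDegree (mul_ne_zero Polynomial.X_ne_zero hg0), Nat.cast_lt,
        Polynomial.natDegree_X_mul hg0]
      omega
    · simp [hev]
  have hbot : ∀ n u, u ≤ newtonMin (Nat.card k) hI α u → E n ⊓ orderBall k w u = ⊥ := by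
    rintro n u hu
    rw [eq_bot_iff]
    rintro _ ⟨⟨g, _, rfl⟩, hgu⟩
    by_contra hg0
    have hg : g ≠ 0 := by
      rintro rfl
      exact hg0 (by simp)
    exact not_hasUnboundedOrbit_of_mem hS hα hu hgu (hne g hg)
  -- One more than the dimension that `finrank_le_of_orbit_mem_orderBall` allows; the exponents
  -- below N + T are those for which the orbit is assumed to stay in the ball.
  set N := T * (I.card * I.card * r) + 1
  by_cases hT0 : T = 0
  · subst hT0
    have hc0 : c = 0 := by
      have : 0 < Nat.card k ^ r := pow_pos Nat.card_pos _
      rw [pow_zero, Nat.lt_one_iff] at hT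
      rcases Nat.mul_eq_zero.mp hT with h | h <;> omega
    have hx0 := hcon 0 (by simp)
    refine not_hasUnboundedOrbit_of_mem (hI := hI) hS hα (u := 0) ?_ (x := x) (by simpa [hc0] using hx0) hx
    have := le_newtonMin (hI := hI) (Finite.one_lt_card (α := k)) h0 hc (u := 0) (by simp [hc0])
    exact this
  have hEN : E (N + T) ≤ orderBall k w (-(2 * c)) := by
    rintro _ ⟨g, hg, rfl⟩
    rw [SetLike.mem_coe, Polynomial.mem_degreeLT] at hg
    rw [hev, Polynomial.aeval_eq_sum_range, LinearMap.sum_apply]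
    refine Submodule.sum_mem _ fun i hi => ?_
    rw [LinearMap.smul_apply]
    by_cases hgi : g.coeff i = 0
    · rw [hgi, zero_smul]; exact zero_mem _
    refine Submodule.smul_mem _ _ (hcon i ?_)
    have hi' : i < N + T := by
      have := (Polynomial.le_degree_of_ne_zero hgi).trans_lt hg
      exact_mod_cast this
    rw [mul_add, mul_one]
    omega
  have h := finrank_le_of_orbit_mem_orderBall (hI := hI) hS hα h0 hr hc hT E hmono hES hbot hEN
  rw [hrank] at h
  have h2 : T * ((newtonSlopes (Nat.card k) I α).card * r) ≤ T * (I.card * I.card * r) :=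
    Nat.mul_le_mul_left _ (Nat.mul_le_mul_right _ card_newtonSlopes_le)
  omega

end Orbits

/-! ### Degrees in τ and evaluation of twisted polynomials -/

namespace TwistedPoly

variable {Fq K : Type*} [Field Fq] [Finite Fq] [Field K] [Algebra Fq K]

@[ext] lemma ext {f g : TwistedPoly Fq K} (h : ∀ n, f.coeff n = g.coeff n) : f = g :=
  SkewPolynomial.ext (R := K) h

@[simp] lemma coeff_zero (n : ℕ) : (0 : TwistedPoly Fq K).coeff n = 0 := rfl

@[simp] lemma coeff_add (f g : TwistedPoly Fq K) (n : ℕ) :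
    (f + g).coeff n = f.coeff n + g.coeff n :=
  SkewPolynomial.coeff_add (R := K) f g n

lemma mem_support {f : TwistedPoly Fq K} {n : ℕ} : n ∈ f.support ↔ f.coeff n ≠ 0 :=
  SkewPolynomial.mem_support_iff (R := K)

/-- The additive map sending a twisted polynomial to its coefficient of `τ ^ n`. -/
def coeffHom (n : ℕ) : TwistedPoly Fq K →+ K where
  toFun f := f.coeff n
  map_zero' := rfl
  map_add' f g := coeff_add f g n

lemma coeff_sum {ι : Type*} (s : Finset ι) (f : ι → TwistedPoly Fq K) (n : ℕ) :
    (∑ i ∈ s, f i).coeff n = ∑ i ∈ s, (f i).coeff n :=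
  map_sum (coeffHom n) f s

/-- The twisted polynomial `a τ ^ n`. -/
def mono (n : ℕ) (a : K) : TwistedPoly Fq K := SkewPolynomial.monomial (R := K) n a

lemma coeff_mono (n m : ℕ) (a : K) :
    (mono n a : TwistedPoly Fq K).coeff m = if n = m then a else 0 :=
  SkewPolynomial.coeff_monomial (R := K)

lemma coeff_one (n : ℕ) : (1 : TwistedPoly Fq K).coeff n = if 0 = n then 1 else 0 :=
  coeff_mono 0 n 1

lemma mono_mul_mono (n m : ℕ) (a b : K) :
    (mono n a * mono m b : TwistedPoly Fq K) = mono (n + m) (a * b ^ Nat.card Fq ^ n) := by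
  let : MulSemiringAction (Multiplicative ℕ) K := frobeniusAction Fq K
  refine (SkewPolynomial.monomial_mul_monomial (R := K) n m a b).trans ?_
  rw [SkewPolynomial.φ_iterate_apply]
  rfl

lemma eq_sum_mono (f : TwistedPoly Fq K) {s : Finset ℕ} (hs : f.support ⊆ s) :
    f = ∑ n ∈ s, mono n (f.coeff n) := by
  ext m
  simp only [coeff_sum, coeff_mono]
  rw [Finset.sum_ite_eq']
  split_ifs with h
  · rfl
  · by_contra h1
    exact h (hs (mem_support.mpr h1))

lemma mul_eq_sum (f g : TwistedPoly Fq K) :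
    f * g = ∑ n ∈ f.support, ∑ m ∈ g.support,
      mono (n + m) (f.coeff n * g.coeff m ^ Nat.card Fq ^ n) := by
  conv_lhs => rw [eq_sum_mono f subset_rfl, eq_sum_mono g subset_rfl, Finset.sum_mul_sum]
  simp only [mono_mul_mono]

/-- The degree in `τ`. -/
def tauDegree (f : TwistedPoly Fq K) : ℕ := f.support.sup id

lemma deg_eq (f : TwistedPoly Fq K) : f.deg = Nat.card Fq ^ f.tauDegree := rfl

lemma le_tauDegree {f : TwistedPoly Fq K} {n : ℕ} (h : n ∈ f.support) : n ≤ f.tauDegree :=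
  Finset.le_sup (f := id) h

lemma coeff_eq_zero_of_tauDegree_lt {f : TwistedPoly Fq K} {n : ℕ} (h : f.tauDegree < n) :
    f.coeff n = 0 := by
  by_contra h1
  exact h.not_ge (le_tauDegree (mem_support.mpr h1))

lemma tauDegree_le {f : TwistedPoly Fq K} {d : ℕ} (h : ∀ n, d < n → f.coeff n = 0) :
    f.tauDegree ≤ d := by
  refine Finset.sup_le fun n hn => ?_
  by_contra! h1
  exact mem_support.mp hn (h n h1)

lemma support_nonempty {f : TwistedPoly Fq K} (hf : f ≠ 0) : f.support.Nonempty := by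
  rw [Finset.nonempty_iff_ne_empty]
  intro h
  refine hf (ext fun n => ?_)
  by_contra h1
  have := mem_support.mpr h1
  rw [h] at this
  simp at this

lemma tauDegree_mem_support {f : TwistedPoly Fq K} (hf : f ≠ 0) : f.tauDegree ∈ f.support := by
  obtain ⟨n, hn, h⟩ := Finset.exists_mem_eq_sup _ (support_nonempty hf) (id : ℕ → ℕ)
  rw [tauDegree, h]
  exact hn

lemma tauDegree_add_le (f g : TwistedPoly Fq K) :
    (f + g).tauDegree ≤ max f.tauDegree g.tauDegree := by
  refine tauDegree_le fun n hn => ?_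
  rw [coeff_add, coeff_eq_zero_of_tauDegree_lt ((le_max_left _ _).trans_lt hn),
    coeff_eq_zero_of_tauDegree_lt ((le_max_right _ _).trans_lt hn), add_zero]

lemma tauDegree_mul_le (f g : TwistedPoly Fq K) :
    (f * g).tauDegree ≤ f.tauDegree + g.tauDegree := by
  refine tauDegree_le fun n hn => ?_
  rw [mul_eq_sum, coeff_sum]
  refine Finset.sum_eq_zero fun i hi => ?_
  rw [coeff_sum]
  refine Finset.sum_eq_zero fun j hj => ?_
  rw [coeff_mono, if_neg]
  have := le_tauDegree hi
  have := le_tauDegree hj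
  omega

/-- Only the two leading terms contribute, with coefficient a b^(q^n) ≠ 0. -/
lemma coeff_mul_add {f g : TwistedPoly Fq K} (hf : f ≠ 0) (hg : g ≠ 0) :
    (f * g).coeff (f.tauDegree + g.tauDegree) ≠ 0 := by
  rw [mul_eq_sum, coeff_sum, Finset.sum_eq_single_of_mem _ (tauDegree_mem_support hf), coeff_sum,
    Finset.sum_eq_single_of_mem _ (tauDegree_mem_support hg), coeff_mono, if_pos rfl]
  · exact mul_ne_zero (mem_support.mp (tauDegree_mem_support hf))
      (pow_ne_zero _ (mem_support.mp (tauDegree_mem_support hg)))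
  · intro j hj hne
    rw [coeff_mono, if_neg (by omega)]
  · intro i hi hne
    rw [coeff_sum]
    refine Finset.sum_eq_zero fun j hj => ?_
    rw [coeff_mono, if_neg]
    have := le_tauDegree hi
    have := le_tauDegree hj
    omega

instance : NoZeroDivisors (TwistedPoly Fq K) where
  eq_zero_or_eq_zero_of_mul_eq_zero {f g} h := by
    by_contra! hfg
    refine coeff_mul_add hfg.1 hfg.2 ?_
    rw [h]
    rfl

instance : Nontrivial (TwistedPoly Fq K) :=
  ⟨⟨0, 1, fun h => by simpa [coeff_one] using congrArg (fun f => f.coeff 0) h⟩⟩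

lemma tauDegree_mul {f g : TwistedPoly Fq K} (hf : f ≠ 0) (hg : g ≠ 0) :
    (f * g).tauDegree = f.tauDegree + g.tauDegree :=
  le_antisymm (tauDegree_mul_le f g) (le_tauDegree (mem_support.mpr (coeff_mul_add hf hg)))

lemma tauDegree_one : (1 : TwistedPoly Fq K).tauDegree = 0 := by
  refine Nat.le_zero.mp (tauDegree_le fun n hn => ?_)
  rw [coeff_one, if_neg hn.ne]

lemma tauDegree_pow {f : TwistedPoly Fq K} (hf : f ≠ 0) (n : ℕ) :
    (f ^ n).tauDegree = n * f.tauDegree := by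
  induction n with
  | zero => simp [tauDegree_one]
  | succ n ih => rw [pow_succ, tauDegree_mul (pow_ne_zero n hf) hf, ih]; ring

lemma sum_ne_zero_of_tauDegree_lt {ι : Type*} {s : Finset ι} {f : ι → TwistedPoly Fq K} {m : ι}
    (hm : m ∈ s) (hfm : f m ≠ 0)
    (h : ∀ j ∈ s, j ≠ m → f j = 0 ∨ (f j).tauDegree < (f m).tauDegree) :
    ∑ j ∈ s, f j ≠ 0 := by
  intro h0
  have h1 := congrArg (fun g => g.coeff (f m).tauDegree) h0
  simp only [coeff_sum] at h1
  rw [Finset.sum_eq_single_of_mem m hm] at h1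
  · exact mem_support.mp (tauDegree_mem_support hfm) h1
  · intro j hj hjm
    rcases h j hj hjm with h | h
    · rw [h]; rfl
    · exact coeff_eq_zero_of_tauDegree_lt h

section Eval

variable {L : Type*} [Field L] [Algebra K L]

lemma eval_eq_sum (f : TwistedPoly Fq K) {s : Finset ℕ} (hs : f.support ⊆ s) (x : L) :
    f.eval x = ∑ n ∈ s, algebraMap K L (f.coeff n) * x ^ Nat.card Fq ^ n := by
  refine Finset.sum_subset hs fun n _ hn => ?_
  rw [mem_support, not_not] at hn
  simp [hn]

lemma eval_add_left (f g : TwistedPoly Fq K) (x : L) : (f + g).eval x = f.eval x + g.eval x := by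
  rw [eval_eq_sum f (Finset.subset_union_left (s₂ := g.support ∪ (f + g).support)),
    eval_eq_sum g (Finset.subset_union_left.trans
      (Finset.subset_union_right (s₁ := f.support) (s₂ := g.support ∪ (f + g).support))),
    eval_eq_sum (f + g) (Finset.subset_union_right.trans
      (Finset.subset_union_right (s₁ := f.support) (s₂ := g.support ∪ (f + g).support))),
    ← Finset.sum_add_distrib]
  refine Finset.sum_congr rfl fun n _ => ?_
  rw [coeff_add, map_add, add_mul]

/-- Evaluation at `x` as an additive map. -/
def evalHom (x : L) : TwistedPoly Fq K →+ L where
  toFun f := f.eval x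
  map_zero' := by
    rw [eval_eq_sum 0 subset_rfl]
    simp
  map_add' f g := eval_add_left f g x

lemma eval_sum {ι : Type*} (s : Finset ι) (f : ι → TwistedPoly Fq K) (x : L) :
    (∑ i ∈ s, f i).eval x = ∑ i ∈ s, (f i).eval x :=
  map_sum (evalHom x) f s

lemma eval_mono (n : ℕ) (a : K) (x : L) :
    (mono n a : TwistedPoly Fq K).eval x = algebraMap K L a * x ^ Nat.card Fq ^ n := by
  rw [eval_eq_sum (s := {n})]
  · simp [coeff_mono]
  · intro m hm
    rw [mem_support, coeff_mono] at hm
    by_contra h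
    exact hm (if_neg fun h' => h (by simp [h']))

lemma eval_one (x : L) : (1 : TwistedPoly Fq K).eval x = x := by
  have := eval_mono (Fq := Fq) 0 (1 : K) x
  rw [map_one, one_mul, pow_zero, pow_one] at this
  exact this

lemma sum_pow_card_pow [Algebra Fq L] {ι : Type*} (s : Finset ι) (y : ι → L) (n : ℕ) :
    (∑ i ∈ s, y i) ^ Nat.card Fq ^ n = ∑ i ∈ s, y i ^ Nat.card Fq ^ n := by
  have := Fintype.ofFinite Fq
  rw [Nat.card_eq_fintype_card]
  induction n with
  | zero => simp
  | succ n ih =>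
    have h := map_sum (FiniteField.frobeniusAlgHom Fq L) (fun i => y i ^ Fintype.card Fq ^ n) s
    simp only [FiniteField.coe_frobeniusAlgHom] at h
    simp only [pow_succ, pow_mul]
    rw [← h, ← ih]

lemma eval_mul [Algebra Fq L] (f g : TwistedPoly Fq K) (x : L) :
    (f * g).eval x = f.eval (g.eval x) := by
  rw [mul_eq_sum, eval_sum]
  conv_rhs => rw [eval, eval, ]
  refine Finset.sum_congr rfl fun n _ => ?_
  rw [eval_sum, sum_pow_card_pow, Finset.mul_sum]
  refine Finset.sum_congr rfl fun m _ => ?_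
  rw [eval_mono, map_mul, map_pow, mul_pow, ← pow_mul, ← pow_add, add_comm m n, mul_assoc]

lemma eval_pow [Algebra Fq L] (f : TwistedPoly Fq K) (n : ℕ) (x : L) :
    (f ^ n).eval x = (fun y => f.eval y)^[n] x := by
  induction n with
  | zero => simp [eval_one]
  | succ n ih => rw [pow_succ', eval_mul, ih, Function.iterate_succ_apply']

/-- The `Fq`-linear operator on an extension field defined by a twisted polynomial. -/
def evalLinear [Algebra Fq L] (f : TwistedPoly Fq K) : L →ₗ[Fq] L where
  toFun x := f.eval x
  map_add' x y := by
    simp only [eval, ← Finset.sum_add_distrib, ← mul_add]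
    refine Finset.sum_congr rfl fun n _ => ?_
    have := sum_pow_card_pow (Fq := Fq) Finset.univ ![x, y] n
    simp only [Fin.sum_univ_two, Matrix.cons_val_zero, Matrix.cons_val_one] at this
    rw [this]
  map_smul' c x := by
    have := Fintype.ofFinite Fq
    simp only [eval, Finset.smul_sum, RingHom.id_apply]
    refine Finset.sum_congr rfl fun n _ => ?_
    rw [Algebra.smul_def, Algebra.smul_def, mul_pow, ← map_pow, Nat.card_eq_fintype_card,
      FiniteField.pow_card_pow]
    ring

lemma evalLinear_apply [Algebra Fq L] (f : TwistedPoly Fq K) (x : L) :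
    f.evalLinear x = f.eval x := rfl

lemma evalLinear_pow_apply [Algebra Fq L] (f : TwistedPoly Fq K) (n : ℕ) (x : L) :
    (f.evalLinear ^ n) x = (f ^ n).eval x := by
  rw [eval_pow, Module.End.pow_apply]
  rfl

end Eval

end TwistedPoly

/-! ### Degrees of the operators of a Drinfeld module -/

lemma Algebra.isAlgebraic_adjoin_of_transcendental {k A : Type*} [Field k] [CommRing A] [IsDomain A] [Algebra k A]
    (htr : Algebra.trdeg k A ≤ 1) {b : A} (hb : Transcendental k b) :
    Algebra.IsAlgebraic (Algebra.adjoin k {b}) A := by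
  have hind : AlgebraicIndependent k (fun _ : Unit => b) :=
    (algebraicIndependent_unique_type_iff).mpr hb
  have hbasis := hind.isTranscendenceBasis_of_lift_trdeg_le_of_finite (by simpa using htr)
  have := hbasis.isAlgebraic
  rwa [Set.range_const] at this

namespace DrinfeldModule

section Degree

variable {Fq A K : Type*} [Field Fq] [Finite Fq] [CommRing A] [Algebra Fq A]
  [Field K] [Algebra Fq K] {i : A →ₐ[Fq] K} (φ : DrinfeldModule i)

lemma exists_tauDegree_pos : ∃ b, 0 < (φ.toRingHom b).tauDegree := by
  obtain ⟨b, n, hn, hb⟩ := φ.nontrivial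
  exact ⟨b, (Nat.pos_of_ne_zero hn).trans_le
    (TwistedPoly.le_tauDegree (TwistedPoly.mem_support.mpr hb))⟩

lemma map_algebraMap_ne_zero {c : Fq} (hc : c ≠ 0) : φ.toRingHom (algebraMap Fq A c) ≠ 0 :=
  (map_ne_zero (φ.toRingHom.comp (algebraMap Fq A))).mpr hc

lemma tauDegree_algebraMap (c : Fq) : (φ.toRingHom (algebraMap Fq A c)).tauDegree = 0 := by
  have := Fintype.ofFinite Fq
  rcases eq_or_ne c 0 with rfl | hc
  · rw [map_zero, map_zero]; rfl
  have h := congrArg (fun c => (φ.toRingHom (algebraMap Fq A c)).tauDegree)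
    (FiniteField.pow_card_sub_one_eq_one c hc)
  simp only [map_pow, map_one, TwistedPoly.tauDegree_one] at h
  rw [TwistedPoly.tauDegree_pow (φ.map_algebraMap_ne_zero hc)] at h
  have h1 : Fintype.card Fq - 1 ≠ 0 := by
    have := Fintype.one_lt_card (α := Fq)
    omega
  exact (Nat.mul_eq_zero.mp h).resolve_left h1

/-- Constants have degree 0 in τ, so the images of distinct powers of b have distinct degrees and
cannot cancel. -/
lemma map_aeval_ne_zero {b : A} (hb : 0 < (φ.toRingHom b).tauDegree) {P : Polynomial Fq}
    (hP : P ≠ 0) : φ.toRingHom (Polynomial.aeval b P) ≠ 0 := by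
  have hb0 : φ.toRingHom b ≠ 0 := by
    intro h
    rw [h] at hb
    exact hb.ne rfl
  have hterm : ∀ j, P.coeff j ≠ 0 → φ.toRingHom (P.coeff j • b ^ j) ≠ 0 ∧
      (φ.toRingHom (P.coeff j • b ^ j)).tauDegree = j * (φ.toRingHom b).tauDegree := by
    intro j hj
    have h := φ.map_algebraMap_ne_zero hj
    rw [Algebra.smul_def, map_mul, map_pow]
    refine ⟨mul_ne_zero h (pow_ne_zero _ hb0), ?_⟩
    rw [TwistedPoly.tauDegree_mul h (pow_ne_zero _ hb0), TwistedPoly.tauDegree_pow hb0,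
      φ.tauDegree_algebraMap, zero_add]
  have hlead : P.coeff P.natDegree ≠ 0 := by simpa using hP
  rw [Polynomial.aeval_eq_sum_range, map_sum]
  refine TwistedPoly.sum_ne_zero_of_tauDegree_lt (Finset.self_mem_range_succ _)
    (hterm _ hlead).1 fun j hj hne => ?_
  by_cases hj0 : P.coeff j = 0
  · left; rw [hj0, zero_smul, map_zero]
  · right
    rw [(hterm _ hj0).2, (hterm _ hlead).2]
    have : j < P.natDegree := by have := Finset.mem_range.mp hj; omega
    exact Nat.mul_lt_mul_of_pos_right this hb

lemma transcendental_of_tauDegree_pos {b : A} (hb : 0 < (φ.toRingHom b).tauDegree) :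
    Transcendental Fq b := by
  rintro ⟨P, hP, h⟩
  refine φ.map_aeval_ne_zero hb hP ?_
  rw [h, map_zero]

variable [IsDomain A]

/-- As u is algebraic over the polynomials in b, it divides some nonzero P(b), namely the constant
term of an algebraic relation. Killing u would kill P(b). -/
lemma map_ne_zero_of_trdeg (htr : Algebra.trdeg Fq A ≤ 1) {u : A} (hu : u ≠ 0) :
    φ.toRingHom u ≠ 0 := by
  intro hφu
  obtain ⟨b, hb⟩ := φ.exists_tauDegree_pos
  have halg := Algebra.isAlgebraic_adjoin_of_transcendental htr (φ.transcendental_of_tauDegree_pos hb)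
  obtain ⟨p, hp0, hp⟩ := (halg.isAlgebraic u).exists_nonzero_coeff_and_aeval_eq_zero
    (mem_nonZeroDivisors_of_ne_zero hu)
  have hrange : ∀ d ∈ Algebra.adjoin Fq {b}, ∃ P, Polynomial.aeval b P = d := fun d hd => by
    rwa [Algebra.adjoin_singleton_eq_range_aeval] at hd
  obtain ⟨P, hP⟩ := hrange _ (p.coeff 0).2
  have hP0 : P ≠ 0 := by
    rintro rfl
    refine hp0 (Subtype.ext ?_)
    rw [← hP, map_zero]
    rfl
  refine φ.map_aeval_ne_zero hb hP0 ?_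
  have h1 : Polynomial.aeval b P = - (u * Polynomial.aeval u p.divX) := by
    rw [← Polynomial.divX_mul_X_add p] at hp
    simp only [map_add, map_mul, Polynomial.aeval_X, Polynomial.aeval_C] at hp
    have hP : Polynomial.aeval b P = algebraMap (Algebra.adjoin Fq {b}) A (p.coeff 0) := hP
    rw [hP]
    linear_combination hp
  rw [h1, map_neg, map_mul, hφu, zero_mul, neg_zero]

/-- If the image of a had degree 0, so would that of every polynomial in a. In an algebraic relation
for b over these, the terms would have distinct degrees and could not sum to zero. -/
lemma tauDegree_pos_of_transcendental (htr : Algebra.trdeg Fq A ≤ 1) {a : A}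
    (ha : Transcendental Fq a) : 0 < (φ.toRingHom a).tauDegree := by
  by_contra hcon
  have ha0 : (φ.toRingHom a).tauDegree = 0 := by omega
  obtain ⟨b, hb⟩ := φ.exists_tauDegree_pos
  have hb0 : φ.toRingHom b ≠ 0 := by
    intro h
    rw [h] at hb
    exact hb.ne rfl
  have halg := Algebra.isAlgebraic_adjoin_of_transcendental htr ha
  have hconst : ∀ d ∈ Algebra.adjoin Fq {a}, (φ.toRingHom d).tauDegree = 0 := by
    intro d hd
    induction hd using Algebra.adjoin_induction with
    | mem x hx => rw [Set.mem_singleton_iff.mp hx, ha0]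
    | algebraMap c => exact φ.tauDegree_algebraMap c
    | add x y _ _ hx hy =>
      have := TwistedPoly.tauDegree_add_le (φ.toRingHom x) (φ.toRingHom y)
      rw [← map_add] at this
      omega
    | mul x y _ _ hx hy =>
      have := TwistedPoly.tauDegree_mul_le (φ.toRingHom x) (φ.toRingHom y)
      rw [← map_mul] at this
      omega
  obtain ⟨p, hp0, hp⟩ := halg.isAlgebraic b
  have hterm : ∀ j, p.coeff j ≠ 0 → φ.toRingHom (p.coeff j • b ^ j) ≠ 0 ∧
      (φ.toRingHom (p.coeff j • b ^ j)).tauDegree = j * (φ.toRingHom b).tauDegree := by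
    intro j hj
    have h : φ.toRingHom (p.coeff j : A) ≠ 0 :=
      φ.map_ne_zero_of_trdeg htr fun h => hj (Subtype.ext h)
    rw [Algebra.smul_def, map_mul, map_pow]
    refine ⟨mul_ne_zero h (pow_ne_zero _ hb0), ?_⟩
    have h2 : (φ.toRingHom (p.coeff j : A)).tauDegree = 0 := hconst _ (p.coeff j).2
    exact (TwistedPoly.tauDegree_mul h (pow_ne_zero _ hb0)).trans
      (by rw [TwistedPoly.tauDegree_pow hb0, h2, zero_add])
  have hlead : p.coeff p.natDegree ≠ 0 := by simpa using hp0
  have hne : φ.toRingHom (Polynomial.aeval b p) ≠ 0 := by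
    rw [Polynomial.aeval_eq_sum_range, map_sum]
    refine TwistedPoly.sum_ne_zero_of_tauDegree_lt (Finset.self_mem_range_succ _)
      (hterm _ hlead).1 fun j hj hne => ?_
    by_cases hj0 : p.coeff j = 0
    · left; rw [hj0, zero_smul, map_zero]
    · right
      rw [(hterm _ hj0).2, (hterm _ hlead).2]
      have : j < p.natDegree := by have := Finset.mem_range.mp hj; omega
      exact Nat.mul_lt_mul_of_pos_right this hb
  rw [hp, map_zero] at hne
  exact hne rfl

/-- A Drinfeld module of finite characteristic has a nonconstant `t` such that `φ t` is
inseparable. -/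
lemma IsFiniteCharacteristic.exists_transcendental {φ : DrinfeldModule i}
    (hφ : φ.IsFiniteCharacteristic) :
    ∃ t : A, Transcendental Fq t ∧ (φ.toRingHom t).coeff 0 = 0 := by
  obtain ⟨t, ht, ht0⟩ := Submodule.exists_mem_ne_zero_of_ne_bot hφ
  refine ⟨t, fun halg => ?_, by rw [φ.coeff_zero]; exact ht⟩
  -- Since `i` kills t, applying it to such a relation leaves the constant term, which would have to
  -- vanish.
  obtain ⟨p, hp0, hp⟩ := halg.exists_nonzero_coeff_and_aeval_eq_zero
    (mem_nonZeroDivisors_of_ne_zero ht0)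
  have h := congrArg i hp
  rw [map_zero, ← Polynomial.aeval_algHom_apply, RingHom.mem_ker.mp ht,
    Polynomial.aeval_def, Polynomial.eval₂_at_zero] at h
  exact hp0 ((map_eq_zero _).mp h)

end Degree

end DrinfeldModule

/-! ### Limits along iterates of quasi-homogeneous maps -/

section Tate

open Filter Topology

variable {X : Type*} {h : X → ℝ} {s t : X → X} {α β B B' : ℝ}

/-- Tate's telescoping argument: consecutive quotients differ by at most B / α ^ (n + 1). -/
lemma tendsto_iterate_div_pow (hα : 1 < α) (hs : ∀ y, |h (s y) - α * h y| ≤ B) :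
    ∃ H : X → ℝ, (∀ y, Tendsto (fun n : ℕ => h (s^[n] y) / α ^ n) atTop (𝓝 (H y))) ∧
      ∃ C, ∀ y, |h y - H y| ≤ C := by
  have hα0 : 0 < α := by linarith
  have hinv : α⁻¹ < 1 := inv_lt_one_of_one_lt₀ hα
  have hdist : ∀ y (n : ℕ), dist (h (s^[n] y) / α ^ n) (h (s^[n + 1] y) / α ^ (n + 1)) ≤
      B / α * α⁻¹ ^ n := by
    intro y n
    have e : h (s^[n] y) / α ^ n - h (s^[n + 1] y) / α ^ (n + 1) =
        -(h (s (s^[n] y)) - α * h (s^[n] y)) / α ^ (n + 1) := by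
      rw [Function.iterate_succ_apply']
      field_simp
      ring
    rw [Real.dist_eq, e, abs_div, abs_neg, abs_of_pos (pow_pos hα0 _), div_le_iff₀ (pow_pos hα0 _)]
    refine (hs _).trans (le_of_eq ?_)
    rw [inv_pow, pow_succ]
    field_simp
  have hex : ∀ y, ∃ l, Tendsto (fun n : ℕ => h (s^[n] y) / α ^ n) atTop (𝓝 l) := fun y =>
    cauchySeq_tendsto_of_complete (cauchySeq_of_le_geometric _ _ hinv (hdist y))
  choose H hH using hex
  refine ⟨H, hH, B / α / (1 - α⁻¹), fun y => ?_⟩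
  have := dist_le_of_le_geometric_of_tendsto₀ _ _ hinv (hdist y) (hH y)
  simpa [Real.dist_eq] using this

lemma limit_comp_eq_mul (hα : 1 < α) {H : X → ℝ}
    (hH : ∀ y, Tendsto (fun n : ℕ => h (s^[n] y) / α ^ n) atTop (𝓝 (H y)))
    (ht : ∀ y, |h (t y) - β * h y| ≤ B) (hst : Function.Commute s t) (y : X) :
    H (t y) = β * H y := by
  refine tendsto_nhds_unique (hH (t y)) ?_
  have hα0 : 0 < α := by linarith
  have h1 : Tendsto (fun n : ℕ => β * (h (s^[n] y) / α ^ n)) atTop (𝓝 (β * H y)) :=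
    (hH y).const_mul β
  have h2 : Tendsto (fun n : ℕ => B / α ^ n) atTop (𝓝 0) :=
    (tendsto_pow_atTop_atTop_of_one_lt hα).const_div_atTop B
  refine h1.congr_dist (squeeze_zero (fun _ => dist_nonneg) (fun n => ?_) h2)
  rw [dist_comm, Real.dist_eq, (hst.iterate_left n).eq, mul_div_assoc', ← sub_div, abs_div,
    abs_of_pos (a := α ^ n) (by positivity)]
  exact div_le_div_of_nonneg_right (ht _) (by positivity)

/-- H is multiplied exactly by β under t and differs from h by a bounded amount, which division by β
^ n removes. This makes the limit independent of the element of A. -/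
lemma limit_eq_of_commute (hα : 1 < α) (hβ : 1 < β) {H : X → ℝ} {C : ℝ}
    (hH : ∀ y, Tendsto (fun n : ℕ => h (s^[n] y) / α ^ n) atTop (𝓝 (H y)))
    (hC : ∀ y, |h y - H y| ≤ C)
    (ht : ∀ y, |h (t y) - β * h y| ≤ B) (hst : Function.Commute s t) (y : X) :
    Tendsto (fun n : ℕ => h (t^[n] y) / β ^ n) atTop (𝓝 (H y)) := by
  have hiter : ∀ n : ℕ, H (t^[n] y) = β ^ n * H y := by
    intro n
    induction n with
    | zero => simp
    | succ n ih =>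
      rw [Function.iterate_succ_apply', limit_comp_eq_mul hα hH ht hst, ih]
      ring
  have h2 : Tendsto (fun n : ℕ => C / β ^ n) atTop (𝓝 0) :=
    (tendsto_pow_atTop_atTop_of_one_lt hβ).const_div_atTop C
  refine (tendsto_const_nhds (x := H y)).congr_dist
    (squeeze_zero (fun _ => dist_nonneg) (fun n => ?_) h2)
  have hpos : 0 < β ^ n := pow_pos (by linarith) n
  have e : H y = H (t^[n] y) / β ^ n := by rw [hiter]; field_simp
  rw [dist_comm, Real.dist_eq, e, ← sub_div, abs_div, abs_of_pos hpos]
  exact div_le_div_of_nonneg_right (hC _) hpos.le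

end Tate

/-! ### Truncated orders and the local limit V_w -/

section TruncOrd

variable {k L : Type*} [Field k] [Finite k] [Field L] [Algebra k L] {w : Valuation L ℤᵐ⁰}

lemma truncOrd_nonpos (y : L) : truncOrd w y ≤ 0 := min_le_left _ _

lemma truncOrd_of_eq_exp {u : ℤ} {y : L} (hy : w y = WithZero.exp (-u)) :
    truncOrd w y = min 0 u := by
  rw [truncOrd, hy, WithZero.log_exp, neg_neg]

lemma le_truncOrd_of_mem {u : ℤ} (hu : u ≤ 0) {y : L} (hy : y ∈ orderBall k w u) :
    u ≤ truncOrd w y := by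
  refine le_min hu ?_
  rcases eq_or_ne (w y) 0 with h | h
  · simpa [h] using hu
  · have := (WithZero.log_le_iff_le_exp h).mpr hy
    omega

end TruncOrd

namespace TwistedPoly

variable {Fq K L : Type*} [Field Fq] [Finite Fq] [Field K] [Algebra Fq K] [Field L] [Algebra K L]
  (w : Valuation L ℤᵐ⁰)

/-- The order of the coefficient of `τ ^ n`. -/
def coeffOrd (L : Type*) [Field L] [Algebra K L] (w : Valuation L ℤᵐ⁰) (f : TwistedPoly Fq K)
    (n : ℕ) : ℤ :=
  -WithZero.log (w (algebraMap K L (f.coeff n)))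

lemma val_coeff_eq_exp (f : TwistedPoly Fq K) (n : ℕ) (hn : n ∈ f.support) :
    w (algebraMap K L (f.coeff n)) = WithZero.exp (-f.coeffOrd L w n) := by
  rw [coeffOrd, neg_neg, WithZero.exp_log]
  rw [Valuation.ne_zero_iff]
  exact (map_ne_zero _).mpr (mem_support.mp hn)

variable [Algebra Fq L]

lemma evalLinear_eq_sum (f : TwistedPoly Fq K) (y : L) :
    f.evalLinear y = ∑ n ∈ f.support, algebraMap K L (f.coeff n) * y ^ Nat.card Fq ^ n := rfl

/-- Outside the ball at -2c the order transforms exactly by the leading monomial; inside, both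
truncated orders are bounded. -/
lemma exists_abs_truncOrd_eval_sub_le {f : TwistedPoly Fq K} (hf : f ≠ 0) :
    ∃ B : ℝ, ∀ y : L, |(truncOrd w (f.eval y) : ℝ) - f.deg * truncOrd w y| ≤ B := by
  have hrI := tauDegree_mem_support hf
  set r := f.tauDegree with hr
  obtain ⟨c, hc⟩ : ∃ c : ℕ, ∀ n ∈ f.support, |f.coeffOrd L w n| ≤ c := by
    refine ⟨f.support.sup fun n => (f.coeffOrd L w n).natAbs, fun n hn => ?_⟩
    rw [Int.abs_eq_natAbs]
    exact_mod_cast Finset.le_sup (f := fun n => (f.coeffOrd L w n).natAbs) hn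
  have hα := val_coeff_eq_exp (L := L) w f
  have hS := evalLinear_eq_sum (L := L) f
  have hI : f.support.Nonempty := ⟨_, hrI⟩
  set m := newtonMin (Nat.card Fq) hI (f.coeffOrd L w) (-(2 * c)) with hm
  have hdeg : (f.deg : ℤ) = (Nat.card Fq : ℤ) ^ r := by rw [deg_eq]; simp [hr]
  have hint : ∀ y : L, |truncOrd w (f.eval y) - f.deg * truncOrd w y| ≤
      |m| + f.deg * (2 * c) + c := by
    intro y
    have h1 := truncOrd_nonpos (w := w) y
    have h2 := truncOrd_nonpos (w := w) (f.eval y)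
    have h3 : (0 : ℤ) ≤ f.deg := by positivity
    have hm0 := abs_nonneg m
    have hc0 : (0 : ℤ) ≤ c := by positivity
    by_cases hy : y ∈ orderBall Fq w (-(2 * c))
    · have h4 := le_truncOrd_of_mem (by omega) hy
      have h5 : f.evalLinear y ∈ orderBall Fq w (-|m|) :=
        orderBall_anti (neg_abs_le m) (map_mem_orderBall (hI := hI) hS hα hy)
      have h6 := le_truncOrd_of_mem (by omega) h5
      rw [evalLinear_apply] at h6
      have h7 := mul_le_mul_of_nonneg_left h4 h3
      have h8 := mul_nonpos_of_nonneg_of_nonpos h3 h1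
      rw [abs_le]
      constructor <;> linarith
    · obtain ⟨u, hu, hyu⟩ := exists_eq_exp_of_notMem hy
      have h4 := val_map_of_notMem_orderBall hS hα hrI (fun i hi => le_tauDegree hi) hc hu hyu
      rw [evalLinear_apply] at h4
      rw [truncOrd_of_eq_exp h4, truncOrd_of_eq_exp hyu, min_eq_right (by omega : u ≤ 0), hdeg]
      have h5 := abs_le.mp (hc r hrI)
      have h6 : (Nat.card Fq : ℤ) ^ r * u ≤ 0 :=
        mul_nonpos_of_nonneg_of_nonpos (by positivity) (by omega)
      have h7 : (0 : ℤ) ≤ (Nat.card Fq : ℤ) ^ r * (2 * c) := by positivity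
      rw [abs_le]
      rcases min_cases (0 : ℤ) (f.coeffOrd L w r + (Nat.card Fq : ℤ) ^ r * u) with h | h <;>
        constructor <;> linarith [h.1, h.2]
  refine ⟨((|m| + f.deg * (2 * c) + c : ℤ) : ℝ), fun y => ?_⟩
  exact_mod_cast hint y

end TwistedPoly

namespace DrinfeldModule

open Filter Topology

variable {Fq A K : Type*} [Field Fq] [Finite Fq] [CommRing A] [Algebra Fq A] [IsDomain A]
  [Field K] [Algebra Fq K] {i : A →ₐ[Fq] K} (φ : DrinfeldModule i)
  {L : Type*} [Field L] [Algebra K L] [Algebra Fq L] (w : Valuation L ℤᵐ⁰)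

lemma one_lt_deg (htr : Algebra.trdeg Fq A ≤ 1) {a : A} (ha : Transcendental Fq a) :
    (1 : ℝ) < (φ.toRingHom a).deg := by
  rw [TwistedPoly.deg_eq]
  exact_mod_cast one_lt_pow₀ Finite.one_lt_card
    (φ.tauDegree_pos_of_transcendental htr ha).ne'

lemma ne_zero_of_transcendental (htr : Algebra.trdeg Fq A ≤ 1) {a : A}
    (ha : Transcendental Fq a) : φ.toRingHom a ≠ 0 := by
  intro h
  have := φ.tauDegree_pos_of_transcendental htr ha
  rw [h] at this
  exact this.ne rfl

lemma truncOrd_pow_div (htr : Algebra.trdeg Fq A ≤ 1) {a : A}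
    (ha : Transcendental Fq a) (x : L) (n : ℕ) :
    (truncOrd w ((φ.toRingHom (a ^ n)).eval x) : ℝ) / ((φ.toRingHom (a ^ n)).deg : ℝ) =
      (truncOrd w ((fun y => (φ.toRingHom a).eval y)^[n] x) : ℝ) /
        ((φ.toRingHom a).deg : ℝ) ^ n := by
  rw [map_pow, TwistedPoly.eval_pow, TwistedPoly.deg_eq,
    TwistedPoly.tauDegree_pow (φ.ne_zero_of_transcendental htr ha), TwistedPoly.deg_eq, mul_comm,
    pow_mul]
  simp

/-- The limit defining `V_w` exists for every nonconstant element of `A` and does not depend on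
this element. -/
lemma exists_tendsto_truncOrd (htr : Algebra.trdeg Fq A ≤ 1) {t : A} (ht : Transcendental Fq t) :
    ∃ H : L → ℝ, (∀ a, Transcendental Fq a → ∀ x, φ.limitOrd a w x = H x) ∧
      (∀ x, Tendsto (fun n : ℕ => (truncOrd w ((φ.toRingHom (t ^ n)).eval x) : ℝ) /
        (φ.toRingHom (t ^ n)).deg) atTop (𝓝 (H x))) ∧
      ∀ x, H ((φ.toRingHom t).eval x) = (φ.toRingHom t).deg * H x := by
  let h : L → ℝ := fun y => (truncOrd w y : ℝ)
  let s : A → L → L := fun a y => (φ.toRingHom a).eval y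
  have hcomm : ∀ a b, Function.Commute (s a) (s b) := fun a b y => by
    simp only [s, ← TwistedPoly.eval_mul, ← map_mul, mul_comm a b]
  have hquasi : ∀ a, Transcendental Fq a →
      ∃ B : ℝ, ∀ y, |h (s a y) - (φ.toRingHom a).deg * h y| ≤ B := fun a ha =>
    TwistedPoly.exists_abs_truncOrd_eval_sub_le w (φ.ne_zero_of_transcendental htr ha)
  obtain ⟨B, hB⟩ := hquasi t ht
  obtain ⟨H, hH, C, hC⟩ := tendsto_iterate_div_pow (φ.one_lt_deg htr ht) hB
  refine ⟨H, fun a ha x => ?_, fun x => ?_, fun x => ?_⟩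
  · obtain ⟨B', hB'⟩ := hquasi a ha
    have := limit_eq_of_commute (φ.one_lt_deg htr ht) (φ.one_lt_deg htr ha) hH hC hB'
      (hcomm t a) x
    refine Tendsto.limUnder_eq (this.congr fun n => ?_)
    exact (φ.truncOrd_pow_div w htr ha x n).symm
  · exact (hH x).congr fun n => (φ.truncOrd_pow_div w htr ht x n).symm
  · exact limit_comp_eq_mul (φ.one_lt_deg htr ht) hH hB (hcomm t t) x

/-- The local estimate: if `V_w(x) < 0`, and the orders of the coefficients of the inseparable
operator `φ t` are at most `c` in absolute value, then `V_w(x) ≤ - q ^ (- r T k)`, if `q ^ T` is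
larger than `2 c q ^ r`. -/
theorem limitOrd_le_of_neg (htr : Algebra.trdeg Fq A ≤ 1) {t : A} (ht : Transcendental Fq t)
    (ht0 : (φ.toRingHom t).coeff 0 = 0) {c : ℕ}
    (hc : ∀ n ∈ (φ.toRingHom t).support, |(φ.toRingHom t).coeffOrd L w n| ≤ c) {T : ℕ}
    (hT : 2 * c * Nat.card Fq ^ (φ.toRingHom t).tauDegree < Nat.card Fq ^ T)
    {a : A} (ha : Transcendental Fq a) {x : L} (hx : φ.limitOrd a w x < 0) :
    φ.limitOrd a w x ≤ -(((φ.toRingHom t).deg : ℝ) ^ (T * ((φ.toRingHom t).support.card *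
      (φ.toRingHom t).support.card * (φ.toRingHom t).tauDegree + 1)))⁻¹ := by
  obtain ⟨H, hHa, hHt, hHeval⟩ := φ.exists_tendsto_truncOrd w htr ht
  rw [hHa a ha] at hx ⊢
  set f := φ.toRingHom t with hf
  set r := f.tauDegree
  have hf0 : f ≠ 0 := φ.ne_zero_of_transcendental htr ht
  have hrI : r ∈ f.support := TwistedPoly.tauDegree_mem_support hf0
  have hr : ∀ n ∈ f.support, n ≤ r := fun n hn => TwistedPoly.le_tauDegree hn
  have h0 : 0 ∉ f.support := fun h => TwistedPoly.mem_support.mp h ht0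
  have hα := TwistedPoly.val_coeff_eq_exp (L := L) w f
  have hS := TwistedPoly.evalLinear_eq_sum (L := L) f
  have hdeg1 : (1 : ℝ) < f.deg := φ.one_lt_deg htr ht
  have hdegn : ∀ n : ℕ, ((φ.toRingHom (t ^ n)).deg : ℝ) = (f.deg : ℝ) ^ n := fun n => by
    rw [map_pow, TwistedPoly.deg_eq, TwistedPoly.tauDegree_pow hf0, TwistedPoly.deg_eq, mul_comm,
      pow_mul]
    push_cast
    rfl
  have heval : ∀ (n : ℕ) (y : L),
      (φ.toRingHom (t ^ n)).eval y = (f.evalLinear (L := L) ^ n) y := fun n y => by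
    rw [map_pow, TwistedPoly.evalLinear_pow_apply]
  -- Along a bounded orbit the numerators stay bounded below, and the limit would be 0.
  have hunb : HasUnboundedOrbit Fq w (f.evalLinear (L := L)) x := by
    by_contra hb
    simp only [HasUnboundedOrbit, not_forall, not_exists, not_not] at hb
    obtain ⟨u, hu⟩ := hb
    have hlow : ∀ n : ℕ, ((min 0 u : ℤ) : ℝ) / (f.deg : ℝ) ^ n ≤
        (truncOrd w ((φ.toRingHom (t ^ n)).eval x) : ℝ) / (φ.toRingHom (t ^ n)).deg := by
      intro n
      rw [hdegn, heval]
      refine div_le_div_of_nonneg_right ?_ (by positivity)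
      exact_mod_cast le_truncOrd_of_mem (min_le_left _ _)
        (orderBall_anti (min_le_right _ _) (hu n))
    have hlim : Tendsto (fun n : ℕ => ((min 0 u : ℤ) : ℝ) / (f.deg : ℝ) ^ n) atTop (𝓝 0) :=
      (tendsto_pow_atTop_atTop_of_one_lt hdeg1).const_div_atTop _
    exact (le_of_tendsto_of_tendsto' hlim (hHt x) hlow).not_gt hx
  obtain ⟨n, hn, hnx⟩ := hunb.exists_notMem_orderBall hS hα h0 hrI hr hc hT
  set z := (f.evalLinear (L := L) ^ n) x with hz
  have hHz : H z = (f.deg : ℝ) ^ n * H x := by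
    rw [hz]
    clear_value z
    clear hn hnx hz
    induction n with
    | zero => simp
    | succ n ih =>
      rw [pow_succ', Module.End.mul_apply, TwistedPoly.evalLinear_apply, hHeval, ih]
      ring
  -- The shift by c makes the induction close: with D = `f.deg` ≥ 2 and u' = `α r` + D u, we have u'
  -- + c ≤ D u + 2c ≤ D (u + c).
  have hesc : ∀ j : ℕ, ∃ u : ℤ, u + c ≤ -((f.deg : ℤ) ^ j) ∧ u < -(2 * c) ∧
      w ((f.evalLinear (L := L) ^ j) z) = WithZero.exp (-u) := by
    intro j
    have hd1 : (1 : ℤ) ≤ f.deg := by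
      have : (1 : ℝ) ≤ f.deg := hdeg1.le
      exact_mod_cast this
    induction j with
    | zero =>
      obtain ⟨u, hu, hzu⟩ := exists_eq_exp_of_notMem hnx
      exact ⟨u, by rw [pow_zero]; omega, hu, hzu⟩
    | succ j ih =>
      obtain ⟨u, hu1, hu2, hzu⟩ := ih
      have h := val_map_of_notMem_orderBall hS hα hrI hr hc hu2 hzu
      have hd : (Nat.card Fq : ℤ) ^ r = f.deg := by rw [TwistedPoly.deg_eq]; simp [r]
      rw [hd] at h
      have hcr := abs_le.mp (hc r hrI)
      have hd2 : (2 : ℤ) ≤ f.deg := by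
        have : (1 : ℤ) < f.deg := by exact_mod_cast hdeg1
        omega
      refine ⟨_, ?_, ?_, by rw [pow_succ', Module.End.mul_apply]; exact h⟩
      · have h1 := mul_le_mul_of_nonneg_left hu1 (by omega : (0 : ℤ) ≤ f.deg)
        have h2 := mul_le_mul_of_nonneg_right hd2 (by positivity : (0 : ℤ) ≤ c)
        rw [pow_succ]
        linarith
      · nlinarith
  have hHz1 : H z ≤ -1 := by
    refine le_of_tendsto' (hHt z) fun j => ?_
    obtain ⟨u, hu1, hu2, hzu⟩ := hesc j
    rw [hdegn, heval, truncOrd_of_eq_exp hzu, min_eq_right (by omega),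
      div_le_iff₀ (pow_pos (by linarith) j)]
    have : u ≤ -((f.deg : ℤ) ^ j) := by omega
    have h' : (u : ℝ) ≤ -((f.deg : ℝ) ^ j) := by exact_mod_cast this
    linarith
  rw [hHz] at hHz1
  have hpos : (0 : ℝ) < (f.deg : ℝ) ^ n := pow_pos (by linarith) n
  have h1 : H x ≤ -((f.deg : ℝ) ^ n)⁻¹ := by
    rw [← neg_le_neg_iff, neg_neg, inv_le_iff_one_le_mul₀' hpos]
    linarith
  refine h1.trans (neg_le_neg ?_)
  exact inv_anti₀ hpos (pow_le_pow_right₀ hdeg1.le hn)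

end DrinfeldModule

/-! ### Ramification bounds and localization at primes of height one -/

section Ramification

variable {K L : Type*} [Field K] [Field L] [Algebra K L]

/-- The ramification index is at most the degree of the extension. -/
lemma le_finrank_of_dvd_log [FiniteDimensional K L] {w : Valuation L ℤᵐ⁰}
    (hw : Function.Surjective w) {e : ℕ}
    (he : ∀ c : K, c ≠ 0 → (e : ℤ) ∣ WithZero.log (w (algebraMap K L c))) :
    e ≤ Module.finrank K L := by
  obtain ⟨π, hπ⟩ := hw (WithZero.exp 1)
  have hval : ∀ (c : K) (i : ℕ), c ≠ 0 → ∃ m : ℤ, w (c • π ^ i) = WithZero.exp (e * m + i) := by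
    intro c i hc
    obtain ⟨m, hm⟩ := he c hc
    refine ⟨m, ?_⟩
    have hwc : w (algebraMap K L c) ≠ 0 := (Valuation.ne_zero_iff w).mpr ((map_ne_zero _).mpr hc)
    rw [Algebra.smul_def, map_mul, map_pow, hπ, ← WithZero.exp_log hwc, hm, ← WithZero.exp_nsmul,
      ← WithZero.exp_add]
    simp
  classical
  -- Orders of elements of K are multiples of e, so nonzero multiples of distinct powers of the
  -- uniformizer have orders in distinct classes modulo e.
  have hli : LinearIndependent K fun i : Fin e => π ^ (i : ℕ) := by
    rw [Fintype.linearIndependent_iff]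
    intro g hg
    by_contra! hne
    obtain ⟨j₀, hj₀⟩ := hne
    obtain ⟨j, hj, hmax⟩ := Finset.exists_max_image (Finset.univ.filter fun j => g j ≠ 0)
      (fun j => w (g j • π ^ (j : ℕ))) ⟨j₀, by simpa using hj₀⟩
    have hgj : g j ≠ 0 := by simpa using hj
    obtain ⟨m, hm⟩ := hval (g j) j hgj
    have hlt : ∀ i ∈ Finset.univ \ {j}, w (g i • π ^ (i : ℕ)) < w (g j • π ^ (j : ℕ)) := by
      intro i hi
      have hij : i ≠ j := by simpa using hi
      by_cases hgi : g i = 0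
      · rw [hgi, zero_smul, map_zero, hm]
        exact WithZero.exp_pos
      · refine lt_of_le_of_ne (hmax i (by simpa using hgi)) fun h => hij ?_
        obtain ⟨n, hn⟩ := hval (g i) i hgi
        rw [hm, hn, WithZero.exp_inj] at h
        have h1 : ((i : ℕ) : ℤ) % e = ((j : ℕ) : ℤ) % e := by
          have := congrArg (fun z : ℤ => z % e) h
          simpa using this
        rw [Int.emod_eq_of_lt (by positivity) (by exact_mod_cast i.2),
          Int.emod_eq_of_lt (by positivity) (by exact_mod_cast j.2)] at h1
        exact Fin.ext (by exact_mod_cast h1)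
    have h := w.map_sum_eq_of_lt (f := fun i : Fin e => g i • π ^ (i : ℕ)) (Finset.mem_univ j) hlt
    rw [hg, map_zero, hm] at h
    exact WithZero.exp_ne_zero h.symm
  simpa using hli.fintype_card_le_finrank

variable {R : Type*} [CommRing R] [IsDomain R] [IsNoetherianRing R] [IsIntegrallyClosed R]

/-- A noetherian, integrally closed local domain with exactly one nonzero prime is a discrete
valuation ring. -/
lemma isDiscreteValuationRing_localization {p : Ideal R} [p.IsPrime] (hp0 : p ≠ ⊥)
    (hp : ∀ q : Ideal R, q.IsPrime → q ≠ ⊥ → q ≤ p → q = p) :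
    IsDiscreteValuationRing (Localization.AtPrime p) := by
  have hle : p.primeCompl ≤ nonZeroDivisors R := p.primeCompl_le_nonZeroDivisors
  have hnoeth : IsNoetherianRing (Localization.AtPrime p) :=
    IsLocalization.isNoetherianRing p.primeCompl _ inferInstance
  have hic : IsIntegrallyClosed (Localization.AtPrime p) :=
    isIntegrallyClosed_of_isLocalization _ p.primeCompl hle
  have hmax : IsLocalRing.maximalIdeal (Localization.AtPrime p) ≠ ⊥ := by
    intro h
    obtain ⟨x, hx, hx0⟩ := Submodule.exists_mem_ne_zero_of_ne_bot hp0
    have h1 := (IsLocalization.AtPrime.to_map_mem_maximal_iff (Localization.AtPrime p) p x).mpr hx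
    rw [h, Ideal.mem_bot] at h1
    exact hx0 (IsLocalization.injective _ hle (h1.trans (map_zero _).symm))
  have hpir : IsPrincipalIdealRing (Localization.AtPrime p) := by
    have htfae : IsPrincipalIdealRing (Localization.AtPrime p) ↔
        IsIntegrallyClosed (Localization.AtPrime p) ∧ ∀ P : Ideal (Localization.AtPrime p),
          P ≠ ⊥ → P.IsPrime → P = IsLocalRing.maximalIdeal _ :=
      (tfae_of_isNoetherianRing_of_isLocalRing_of_isDomain (Localization.AtPrime p)).out 0 3
    refine htfae.mpr ⟨hic, fun Q hQ0 hQ => ?_⟩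
    refine Localization.AtPrime.eq_maximalIdeal_iff_under_eq.mp
      (hp _ (Ideal.IsPrime.under R Q) (fun h : Q.under R = ⊥ => hQ0 ?_) ?_)
    · have h1 := IsLocalization.map_under p.primeCompl (Localization.AtPrime p) Q
      rw [h, Ideal.map_bot] at h1
      exact h1.symm
    · exact le_of_le_of_eq (Ideal.comap_mono (IsLocalRing.le_maximalIdeal hQ.ne_top))
        (IsLocalization.AtPrime.under_maximalIdeal (Localization.AtPrime p) p)
  exact { hpir with not_a_field' := hmax }

/-- The orders of an element of `R` for the valuations of finite extensions of the fraction field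
that are centered at a fixed prime of height one are bounded by a multiple of the degree. -/
lemma exists_log_le_of_center [Algebra R K] [IsFractionRing R K] {p : Ideal R} [p.IsPrime]
    (hp0 : p ≠ ⊥) (hp : ∀ q : Ideal R, q.IsPrime → q ≠ ⊥ → q ≤ p → q = p) {b : R} (hb : b ≠ 0) :
    ∃ n : ℕ, ∀ (L : Type uL) [Field L] [Algebra K L] [FiniteDimensional K L] (w : Valuation L ℤᵐ⁰),
      Function.Surjective w → (∀ r : R, w (algebraMap K L (algebraMap R K r)) ≤ 1) →
      (∀ r : R, r ∈ p ↔ w (algebraMap K L (algebraMap R K r)) < 1) →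
      |WithZero.log (w (algebraMap K L (algebraMap R K b)))| ≤ n * Module.finrank K L := by
  have hdvr := isDiscreteValuationRing_localization hp0 hp
  have hle : p.primeCompl ≤ nonZeroDivisors R := p.primeCompl_le_nonZeroDivisors
  have hinj : Function.Injective (algebraMap R (Localization.AtPrime p)) :=
    IsLocalization.injective _ hle
  have hunit : ∀ s : p.primeCompl, IsUnit (algebraMap R K s) := fun s =>
    ((map_ne_zero_iff _ (IsFractionRing.injective R K)).mpr
      (nonZeroDivisors.ne_zero (hle s.2))).isUnit
  let σ : Localization.AtPrime p →+* K := IsLocalization.lift hunit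
  have hσ : ∀ r, σ (algebraMap R _ r) = algebraMap R K r := IsLocalization.lift_eq hunit
  obtain ⟨ϖ, hϖ⟩ := IsDiscreteValuationRing.exists_irreducible (Localization.AtPrime p)
  have hfact : ∀ r : R, r ≠ 0 → ∃ (n : ℕ) (u : (Localization.AtPrime p)ˣ),
      algebraMap R (Localization.AtPrime p) r = u * ϖ ^ n := fun r hr =>
    IsDiscreteValuationRing.eq_unit_mul_pow_irreducible
      (fun h => hr (hinj (h.trans (map_zero _).symm))) hϖ
  obtain ⟨n, u, hbu⟩ := hfact b hb
  refine ⟨n, fun L _ _ _ w hw hw1 hwp => ?_⟩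
  let v : Localization.AtPrime p → ℤᵐ⁰ := fun x => w (algebraMap K L (σ x))
  have hvmul : ∀ x y, v (x * y) = v x * v y := fun x y => by simp only [v, map_mul]
  have hvone : v 1 = 1 := by simp only [v, map_one]
  have hv1 : ∀ x, v x ≤ 1 := by
    intro x
    obtain ⟨r, s, rfl⟩ := IsLocalization.exists_mk'_eq p.primeCompl x
    have hs : v (algebraMap R _ (s : R)) = 1 := by
      simp only [v, hσ]
      exact le_antisymm (hw1 s) (not_lt.mp fun h => s.2 ((hwp s).mpr h))
    have h1 : v (IsLocalization.mk' _ r s) * v (algebraMap R _ (s : R)) = v (algebraMap R _ r) := by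
      rw [← hvmul, IsLocalization.mk'_spec]
    rw [hs, mul_one] at h1
    rw [h1]
    simp only [v, hσ]
    exact hw1 r
  have hvu : ∀ u : (Localization.AtPrime p)ˣ, v u = 1 := by
    intro u
    refine le_antisymm (hv1 _) ?_
    have h1 : v u * v (↑u⁻¹ : Localization.AtPrime p) = 1 := by rw [← hvmul, Units.mul_inv, hvone]
    rw [← h1]
    exact mul_le_of_le_one_right' (hv1 _)
  have hvpow : ∀ n, v (ϖ ^ n) = v ϖ ^ n := fun n => by simp only [v, map_pow]
  have hlog : ∀ (r : R) (n : ℕ) (u : (Localization.AtPrime p)ˣ),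
      algebraMap R (Localization.AtPrime p) r = u * ϖ ^ n →
      WithZero.log (w (algebraMap K L (algebraMap R K r))) = n * WithZero.log (v ϖ) := by
    intro r n u h
    have h1 : w (algebraMap K L (algebraMap R K r)) = v ϖ ^ n := by
      rw [← hσ, ← hvpow, ← one_mul (v (ϖ ^ n)), ← hvu u, ← hvmul, ← h]
    rw [h1, WithZero.log_pow, nsmul_eq_mul]
  -- The order of ϖ at w is the ramification index: every order of an element of K is a multiple of
  -- it.
  have he : (WithZero.log (v ϖ)).natAbs ≤ Module.finrank K L := by
    refine le_finrank_of_dvd_log hw fun c hc => ?_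
    rw [Int.natAbs_dvd]
    obtain ⟨r, s, hs, rfl⟩ := IsFractionRing.div_surjective (A := R) c
    have hs0 : s ≠ 0 := nonZeroDivisors.ne_zero hs
    have hr0 : r ≠ 0 := by
      rintro rfl
      exact hc (by simp)
    obtain ⟨n, u, hn⟩ := hfact r hr0
    obtain ⟨m, u', hm⟩ := hfact s hs0
    have hne : ∀ r : R, r ≠ 0 → w (algebraMap K L (algebraMap R K r)) ≠ 0 := fun r hr =>
      (Valuation.ne_zero_iff w).mpr
        ((map_ne_zero _).mpr ((map_ne_zero_iff _ (IsFractionRing.injective R K)).mpr hr))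
    rw [map_div₀, map_div₀, WithZero.log_div (hne r hr0) (hne s hs0), hlog r n u hn,
      hlog s m u' hm]
    exact dvd_sub (dvd_mul_left _ _) (dvd_mul_left _ _)
  rw [hlog b n u hbu, abs_mul, Nat.abs_cast, Int.abs_eq_natAbs]
  exact_mod_cast Nat.mul_le_mul_left n he

end Ramification

/-! ### Orders of elements of K at the places of a finite extension -/

namespace ProjectiveModel

variable {k K : Type*} [Field k] [Field K] [Algebra k K] (V : ProjectiveModel k K)

lemma isFractionRing_chart {j : Fin (V.M + 1)} (hj : V.coord j ≠ 0) :
    IsFractionRing (V.chart j) K := by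
  have htop : IntermediateField.adjoin k {y : K | ∃ i, y = V.coord i / V.coord j} = ⊤ := by
    rw [eq_top_iff, ← V.adjoin_eq_top, IntermediateField.adjoin_le_iff]
    rintro _ ⟨i, i', rfl⟩
    have h : V.coord i / V.coord i' = (V.coord i / V.coord j) / (V.coord i' / V.coord j) := by
      rw [div_div_div_cancel_right₀ hj]
    rw [h]
    exact div_mem (IntermediateField.subset_adjoin _ _ ⟨i, rfl⟩)
      (IntermediateField.subset_adjoin _ _ ⟨i', rfl⟩)
  refine IsFractionRing.of_field _ _ fun z => ?_
  have hz : z ∈ IntermediateField.adjoin k {y : K | ∃ i, y = V.coord i / V.coord j} := by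
    rw [htop]; trivial
  obtain ⟨r, hr, s, hs, h⟩ := IntermediateField.mem_adjoin_iff_div.mp hz
  exact ⟨⟨r, hr⟩, ⟨s, hs⟩, h⟩

lemma isNoetherianRing_chart (j : Fin (V.M + 1)) : IsNoetherianRing (V.chart j) := by
  classical
  refine isNoetherianRing_of_fg
    ⟨Finset.univ.image fun i => V.coord i / V.coord j, congrArg (Algebra.adjoin k) ?_⟩
  ext y
  simp [eq_comm]

/-- If b vanishes at the center p of w in the chart, then p, having height one, is one of the
finitely many minimal primes over b; otherwise b has order 0. The constant is the largest order of b
at these primes. -/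
lemma exists_log_le_of_mem_chart {j : Fin (V.M + 1)} (hj : V.coord j ≠ 0) {b : V.chart j}
    (hb : b ≠ 0) :
    ∃ C : ℕ, ∀ (L : Type uL) [Field L] [Algebra K L] [FiniteDimensional K L] (w : Valuation L ℤᵐ⁰),
      Function.Surjective w → (∀ b : integralClosure (V.chart j) L, w b ≤ 1) →
      (∃ P : Ideal (integralClosure (V.chart j) L), P.IsPrime ∧ P.height = 1 ∧
        ∀ b : integralClosure (V.chart j) L, b ∈ P ↔ w b < 1) →
      |WithZero.log (w (algebraMap K L b))| ≤ C * Module.finrank K L := by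
  have hfrac := V.isFractionRing_chart hj
  have hnoeth := V.isNoetherianRing_chart j
  have hic : IsIntegrallyClosed (V.chart j) := V.normal j hj
  have hfin : (Ideal.span {b}).minimalPrimes.Finite :=
    Ideal.finite_minimalPrimes_of_isNoetherianRing _ _
  have hex : ∀ p : Ideal (V.chart j), ∃ n : ℕ, ∀ (hp' : p.IsPrime), p ≠ ⊥ →
      (∀ q : Ideal (V.chart j), q.IsPrime → q ≠ ⊥ → q ≤ p → q = p) →
      ∀ (L : Type uL) [Field L] [Algebra K L] [FiniteDimensional K L] (w : Valuation L ℤᵐ⁰),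
      Function.Surjective w → (∀ r : V.chart j, w (algebraMap K L (algebraMap (V.chart j) K r)) ≤ 1) →
      (∀ r : V.chart j, r ∈ p ↔ w (algebraMap K L (algebraMap (V.chart j) K r)) < 1) →
      |WithZero.log (w (algebraMap K L (algebraMap (V.chart j) K b)))| ≤
        n * Module.finrank K L := by
    intro p
    by_cases h : p.IsPrime ∧ p ≠ ⊥ ∧
      ∀ q : Ideal (V.chart j), q.IsPrime → q ≠ ⊥ → q ≤ p → q = p
    · have := h.1
      obtain ⟨n, hn⟩ := exists_log_le_of_center (K := K) h.2.1 h.2.2 hb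
      exact ⟨n, fun _ _ _ => hn⟩
    · exact ⟨0, fun h1 h2 h3 => absurd ⟨h1, h2, h3⟩ h⟩
  choose n hn using hex
  refine ⟨hfin.toFinset.sup n, fun L _ _ _ w hw hw1 ⟨P, hP, hPh, hPw⟩ => ?_⟩
  let p : Ideal (V.chart j) := P.under (V.chart j)
  have hval : ∀ r : V.chart j, w (algebraMap K L (algebraMap (V.chart j) K r)) =
      w (algebraMap (V.chart j) (integralClosure (V.chart j) L) r : L) := fun r => rfl
  have hr1 : ∀ r : V.chart j, w (algebraMap K L (algebraMap (V.chart j) K r)) ≤ 1 := fun r =>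
    hw1 (algebraMap (V.chart j) (integralClosure (V.chart j) L) r)
  have hrp : ∀ r : V.chart j, r ∈ p ↔ w (algebraMap K L (algebraMap (V.chart j) K r)) < 1 :=
    fun r => hPw (algebraMap (V.chart j) (integralClosure (V.chart j) L) r)
  have hinj : Function.Injective (algebraMap (V.chart j) (integralClosure (V.chart j) L)) :=
    fun r s h => IsFractionRing.injective (V.chart j) K
      ((algebraMap K L).injective (congrArg Subtype.val h))
  have hP0 : P ≠ ⊥ := Ideal.ne_bot_of_height_eq_one hPh
  have hp0 : p ≠ ⊥ := Ideal.IsIntegral.comap_ne_bot _ hP0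
  -- Going down over the integrally closed chart: a prime strictly between ⊥ and p would lift to one
  -- strictly between ⊥ and P.
  have hp : ∀ q : Ideal (V.chart j), q.IsPrime → q ≠ ⊥ → q ≤ p → q = p := by
    intro q hq hq0 hqp
    by_contra hne
    have hlt : q < p := lt_of_le_of_ne hqp hne
    have hfs : FaithfulSMul (V.chart j) (integralClosure (V.chart j) L) :=
      (faithfulSMul_iff_algebraMap_injective _ _).mpr hinj
    obtain ⟨Q, hQP, hQ, hQq⟩ := Ideal.exists_ideal_lt_liesOver_of_lt (p := q) (q := p) P hlt
    have h1 := Ideal.height_add_one_le_of_lt_of_isPrime hQP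
    rw [hPh] at h1
    have h2 : Q.height = 0 := by
      by_contra h
      have h3 := (add_le_add_left (Order.one_le_iff_ne_zero.mpr h) 1).trans h1
      exact absurd h3 (by decide)
    rw [Ideal.height_eq_zero_iff_eq_bot] at h2
    refine hq0 ?_
    rw [hQq.over, h2, eq_bot_iff]
    intro r hr
    exact hinj (hr.trans (map_zero _).symm)
  by_cases hbp : b ∈ p
  · have hmem : p ∈ (Ideal.span {b}).minimalPrimes := by
      refine ⟨⟨inferInstance, by simpa [Ideal.span_le] using hbp⟩, fun q ⟨hq, hbq⟩ hqp => ?_⟩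
      refine (hp q hq (fun h => hb ?_) hqp).ge
      have := hbq (Ideal.mem_span_singleton_self b)
      rwa [h, Ideal.mem_bot] at this
    refine (hn p inferInstance hp0 hp L w hw hr1 hrp).trans ?_
    have := Finset.le_sup (f := n) (hfin.mem_toFinset.mpr hmem)
    exact_mod_cast Nat.mul_le_mul_right _ this
  · have h1 : w (algebraMap K L b) = 1 :=
      le_antisymm (hr1 b) (not_lt.mp fun h => hbp ((hrp b).mpr h))
    rw [h1, WithZero.log_one, abs_zero]
    positivity

/-- The orders of `a` at the places of `M_L` are bounded by a constant multiple of `[L : K]`. -/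
theorem exists_log_le_mul_finrank {a : K} (ha : a ≠ 0) :
    ∃ C : ℕ, ∀ (L : Type uL) [Field L] [Algebra K L] [FiniteDimensional K L],
      ∀ w ∈ V.divisors L, |WithZero.log (w (algebraMap K L a))| ≤ C * Module.finrank K L := by
  have hex : ∀ j : Fin (V.M + 1), ∃ C : ℕ, V.coord j ≠ 0 →
      ∀ (L : Type uL) [Field L] [Algebra K L] [FiniteDimensional K L] (w : Valuation L ℤᵐ⁰),
      Function.Surjective w → (∀ b : integralClosure (V.chart j) L, w b ≤ 1) →
      (∃ P : Ideal (integralClosure (V.chart j) L), P.IsPrime ∧ P.height = 1 ∧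
        ∀ b : integralClosure (V.chart j) L, b ∈ P ↔ w b < 1) →
      |WithZero.log (w (algebraMap K L a))| ≤ C * Module.finrank K L := by
    intro j
    by_cases hj : V.coord j = 0
    · exact ⟨0, fun h => absurd hj h⟩
    have hfrac := V.isFractionRing_chart hj
    obtain ⟨r, s, hs, rfl⟩ := IsFractionRing.div_surjective (A := V.chart j) a
    have hs0 : s ≠ 0 := nonZeroDivisors.ne_zero hs
    have hr0 : r ≠ 0 := by
      rintro rfl
      exact ha (by simp)
    obtain ⟨C, hC⟩ := V.exists_log_le_of_mem_chart hj hr0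
    obtain ⟨C', hC'⟩ := V.exists_log_le_of_mem_chart hj hs0
    refine ⟨C + C', fun _ L _ _ _ w hw h1 h2 => ?_⟩
    have hne : ∀ r : V.chart j, r ≠ 0 → w (algebraMap K L (algebraMap (V.chart j) K r)) ≠ 0 :=
      fun r hr => (Valuation.ne_zero_iff w).mpr
        ((map_ne_zero _).mpr ((map_ne_zero_iff _ (IsFractionRing.injective _ K)).mpr hr))
    rw [map_div₀, map_div₀, WithZero.log_div (hne r hr0) (hne s hs0)]
    refine (abs_sub _ _).trans ((add_le_add (hC L w hw h1 h2) (hC' L w hw h1 h2)).trans ?_)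
    push_cast
    exact (add_mul _ _ _).ge
  choose C hC using hex
  refine ⟨Finset.univ.sup C, fun L _ _ _ w ⟨hw, j, hj, h1, h2⟩ => ?_⟩
  refine (hC j hj L w hw h1 h2).trans ?_
  exact_mod_cast Nat.mul_le_mul_right _ (Finset.le_sup (f := C) (Finset.mem_univ j))

end ProjectiveModel

/-! ### Growth of the powers of a finite-dimensional space of elements of a field -/

section Growth

variable {k E ι : Type*} [Field k] [Field E] [Algebra k E]

open Classical in
/-- The monomials in `η i`, `i ∈ S`, with all exponents at most `d`. -/
def monomialBox (η : ι → E) (S : Finset ι) (d : ℕ) : Finset E :=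
  (Finset.univ : Finset (S → Fin (d + 1))).image fun β => ∏ i : S, η i ^ (β i : ℕ)

variable {η : ι → E} {S : Finset ι}

lemma card_monomialBox_le (d : ℕ) : (monomialBox η S d).card ≤ (d + 1) ^ S.card := by
  classical
  exact Finset.card_image_le.trans (by simp)

lemma mem_monomialBox {d : ℕ} {x : E} :
    x ∈ monomialBox η S d ↔ ∃ β : S → ℕ, (∀ i, β i ≤ d) ∧ ∏ i : S, η i ^ β i = x := by
  simp only [monomialBox, Finset.mem_image, Finset.mem_univ, true_and]
  constructor
  · rintro ⟨β, rfl⟩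
    exact ⟨fun i => β i, fun i => Nat.lt_succ_iff.mp (β i).2, rfl⟩
  · rintro ⟨β, hβ, rfl⟩
    exact ⟨fun i => ⟨β i, Nat.lt_succ_iff.mpr (hβ i)⟩, rfl⟩

lemma one_mem_monomialBox (d : ℕ) : (1 : E) ∈ monomialBox η S d :=
  mem_monomialBox.mpr ⟨0, fun _ => Nat.zero_le _, by simp⟩

lemma mul_mem_monomialBox {d d' : ℕ} {x y : E} (hx : x ∈ monomialBox η S d)
    (hy : y ∈ monomialBox η S d') : x * y ∈ monomialBox η S (d + d') := by
  obtain ⟨β, hβ, rfl⟩ := mem_monomialBox.mp hx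
  obtain ⟨β', hβ', rfl⟩ := mem_monomialBox.mp hy
  refine mem_monomialBox.mpr ⟨β + β', fun i => add_le_add (hβ i) (hβ' i), ?_⟩
  simp [pow_add, Finset.prod_mul_distrib]

lemma apply_mem_monomialBox {i : ι} (hi : i ∈ S) : η i ∈ monomialBox η S 1 := by
  classical
  refine mem_monomialBox.mpr ⟨Pi.single ⟨i, hi⟩ 1, fun j => ?_, ?_⟩
  · by_cases h : j = ⟨i, hi⟩
    · subst h; simp
    · simp [h]
  · rw [Finset.prod_eq_single ⟨i, hi⟩]
    · simp
    · intro j _ hj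
      simp [hj]
    · simp

variable (k η S) in
/-- The span of the monomials in `η i`, `i ∈ S`, with all exponents at most `d`. -/
def boxSpan (d : ℕ) : Submodule k E := Submodule.span k (monomialBox η S d)

lemma boxSpan_mul_le (d d' : ℕ) : boxSpan k η S d * boxSpan k η S d' ≤ boxSpan k η S (d + d') := by
  rw [boxSpan, boxSpan, Submodule.span_mul_span]
  refine Submodule.span_mono ?_
  rintro _ ⟨x, hx, y, hy, rfl⟩
  exact mul_mem_monomialBox hx hy

lemma boxSpan_mono {d d' : ℕ} (h : d ≤ d') : boxSpan k η S d ≤ boxSpan k η S d' := by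
  refine Submodule.span_mono fun x hx => ?_
  obtain ⟨β, hβ, rfl⟩ := mem_monomialBox.mp hx
  exact mem_monomialBox.mpr ⟨β, fun i => (hβ i).trans h, rfl⟩

lemma exists_mem_boxSpan {x : E} (hx : x ∈ Algebra.adjoin k (η '' S)) :
    ∃ d, x ∈ boxSpan k η S d := by
  induction hx using Algebra.adjoin_induction with
  | mem x hx =>
    obtain ⟨i, hi, rfl⟩ := hx
    exact ⟨1, Submodule.subset_span (apply_mem_monomialBox hi)⟩
  | algebraMap c =>
    refine ⟨0, ?_⟩
    rw [Algebra.algebraMap_eq_smul_one]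
    exact Submodule.smul_mem _ _ (Submodule.subset_span (one_mem_monomialBox 0))
  | add x y _ _ hx hy =>
    obtain ⟨d, hd⟩ := hx
    obtain ⟨d', hd'⟩ := hy
    exact ⟨max d d', add_mem (boxSpan_mono (le_max_left _ _) hd)
      (boxSpan_mono (le_max_right _ _) hd')⟩
  | mul x y _ _ hx hy =>
    obtain ⟨d, hd⟩ := hx
    obtain ⟨d', hd'⟩ := hy
    exact ⟨d + d', boxSpan_mul_le d d' (Submodule.mul_mem_mul hd hd')⟩

lemma exists_mem_boxSpan_mul_span (G : Finset E) {x : E}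
    (hx : x ∈ Submodule.span (Algebra.adjoin k (η '' S)) (G : Set E)) :
    ∃ d, x ∈ boxSpan k η S d * Submodule.span k (G : Set E) := by
  induction hx using Submodule.span_induction with
  | mem x hx =>
    refine ⟨0, ?_⟩
    rw [← one_mul x]
    exact Submodule.mul_mem_mul (Submodule.subset_span (one_mem_monomialBox 0))
      (Submodule.subset_span hx)
  | zero => exact ⟨0, zero_mem _⟩
  | add x y _ _ hx hy =>
    obtain ⟨d, hd⟩ := hx
    obtain ⟨d', hd'⟩ := hy
    exact ⟨max d d', add_mem (mul_le_mul_left (boxSpan_mono (le_max_left _ _)) _ hd)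
      (mul_le_mul_left (boxSpan_mono (le_max_right _ _)) _ hd')⟩
  | smul b x _ hx =>
    obtain ⟨d, hd⟩ := hx
    obtain ⟨d', hd'⟩ := exists_mem_boxSpan b.2
    refine ⟨d' + d, ?_⟩
    have h := Submodule.mul_mem_mul hd' hd
    rw [← mul_assoc] at h
    exact mul_le_mul_left (boxSpan_mul_le d' d) _ h

lemma finrank_boxSpan_mul_span_le (d : ℕ) (G : Finset E) :
    Module.finrank k (boxSpan k η S d * Submodule.span k (G : Set E) : Submodule k E) ≤
      (d + 1) ^ S.card * G.card := by
  classical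
  open Pointwise in
  rw [boxSpan, Submodule.span_mul_span, ← Finset.coe_mul]
  refine (finrank_span_finset_le_card _).trans (Finset.card_mul_le.trans ?_)
  exact Nat.mul_le_mul_right _ (card_monomialBox_le d)

lemma finiteDimensional_boxSpan_mul_span (d : ℕ) (G : Finset E) :
    FiniteDimensional k (boxSpan k η S d * Submodule.span k (G : Set E) : Submodule k E) := by
  classical
  open Pointwise in
  rw [boxSpan, Submodule.span_mul_span, ← Finset.coe_mul]
  exact FiniteDimensional.span_finset k _

/-- Upper bound for the growth of the powers of the span of `η`, if all `η i` are algebraic over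
those with `i ∈ S`. -/
theorem exists_finrank_span_pow_le [Fintype ι]
    (hS : ∀ i, IsAlgebraic (Algebra.adjoin k (η '' S)) (η i)) :
    ∃ D : ℕ, ∀ n : ℕ, Module.finrank k ((Submodule.span k (Set.range η)) ^ n : Submodule k E) ≤
      D * (n + 1) ^ S.card := by
  classical
  set B := Algebra.adjoin k (η '' S)
  -- A common denominator c makes every `η i` integral over B. The algebra generated by the c `η i`
  -- is then a finite B-module, with generators G.
  choose y hy0 hy using fun i => (hS i).exists_integral_multiple
  let c : B := ∏ i, y i
  have hc0 : (c : E) ≠ 0 := by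
    have : c ≠ 0 := Finset.prod_ne_zero_iff.mpr fun i _ => hy0 i
    exact fun h => this (Subtype.ext h)
  have hint : ∀ i, IsIntegral B ((c : E) * η i) := fun i => by
    have h : (c : E) * η i = (∏ j ∈ Finset.univ.erase i, y j : B) • (y i • η i) := by
      rw [smul_smul, Finset.prod_erase_mul _ _ (Finset.mem_univ i)]
      rfl
    rw [h]
    exact (hy i).smul _
  let θ : ι → E := fun i => c * η i
  obtain ⟨G, hG⟩ : (Algebra.adjoin B (Set.range θ)).toSubmodule.FG :=
    fg_adjoin_of_finite (Set.finite_range θ) (by rintro _ ⟨i, rfl⟩; exact hint i)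
  set Z := Submodule.span k (G : Set E)
  have hmemG : ∀ x ∈ Algebra.adjoin B (Set.range θ), ∃ d, x ∈ boxSpan k η S d * Z := by
    intro x hx
    refine exists_mem_boxSpan_mul_span G ?_
    rw [hG]
    exact hx
  have hmem1 : ∀ i, ∀ z : G, ∃ d, θ i * z ∈ boxSpan k η S d * Z := fun i z => by
    refine hmemG _ (mul_mem (Algebra.subset_adjoin ⟨i, rfl⟩) ?_)
    have : (z : E) ∈ Submodule.span B (G : Set E) := Submodule.subset_span z.2
    rw [hG] at this
    exact this
  obtain ⟨d₀, hd₀⟩ := hmemG 1 (one_mem _)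
  choose d hd using hmem1
  let a := max d₀ (Finset.univ.sup fun i => Finset.univ.sup fun z => d i z)
  have had : ∀ i z, d i z ≤ a := fun i z =>
    (Finset.le_sup (f := fun z => d i z) (Finset.mem_univ z)).trans
      ((Finset.le_sup (f := fun i => Finset.univ.sup fun z => d i z) (Finset.mem_univ i)).trans
        (le_max_right _ _))
  set Θ := Submodule.span k (Set.range θ)
  -- Each multiplication by Θ enlarges the exponents of the box by at most the fixed amount a, so
  -- the box for Θ ^ n grows linearly in n.
  have hΘZ : Θ * Z ≤ boxSpan k η S a * Z := by
    rw [Submodule.span_mul_span, Submodule.span_le]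
    rintro _ ⟨_, ⟨i, rfl⟩, z, hz, rfl⟩
    exact mul_le_mul_left (boxSpan_mono (had i ⟨z, hz⟩)) _ (hd i ⟨z, hz⟩)
  have hpow : ∀ n : ℕ, Θ ^ n ≤ boxSpan k η S (a * (n + 1)) * Z := by
    intro n
    induction n with
    | zero =>
      rw [pow_zero, Submodule.one_le, zero_add, mul_one]
      exact mul_le_mul_left (boxSpan_mono (le_max_left _ _)) _ hd₀
    | succ n ih =>
      calc Θ ^ (n + 1) = Θ * Θ ^ n := pow_succ' _ _
        _ ≤ Θ * (boxSpan k η S (a * (n + 1)) * Z) := mul_le_mul_right ih _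
        _ = boxSpan k η S (a * (n + 1)) * (Θ * Z) := by ring
        _ ≤ boxSpan k η S (a * (n + 1)) * (boxSpan k η S a * Z) := mul_le_mul_right hΘZ _
        _ = (boxSpan k η S (a * (n + 1)) * boxSpan k η S a) * Z := (mul_assoc _ _ _).symm
        _ ≤ boxSpan k η S (a * (n + 1 + 1)) * Z := mul_le_mul_left (boxSpan_mul_le _ _) _
  refine ⟨(a + 1) ^ S.card * G.card, fun n => ?_⟩
  set H := Submodule.span k (Set.range η)
  have hcH : Submodule.span k {(c : E)} * H = Θ := by
    rw [Submodule.span_mul_span, Set.singleton_mul, ← Set.range_comp]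
    rfl
  -- Multiplication by c ^ n embeds H ^ n into Θ ^ n.
  have hle : (H ^ n).map (LinearMap.mulLeft k ((c : E) ^ n)) ≤ Θ ^ n := by
    rintro _ ⟨x, hx, rfl⟩
    rw [← hcH, mul_pow]
    exact Submodule.mul_mem_mul (Submodule.pow_mem_pow _ (Submodule.mem_span_singleton_self _) n) hx
  have hinj : Function.Injective (LinearMap.mulLeft k ((c : E) ^ n)) :=
    mul_right_injective₀ (pow_ne_zero n hc0)
  have := finiteDimensional_boxSpan_mul_span (k := k) (η := η) (S := S) (a * (n + 1)) G
  rw [(Submodule.equivMapOfInjective _ hinj (H ^ n)).finrank_eq]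
  refine (Submodule.finrank_mono (hle.trans (hpow n))).trans
    ((finrank_boxSpan_mul_span_le _ G).trans ?_)
  have h1 : a * (n + 1) + 1 ≤ (a + 1) * (n + 1) := by nlinarith
  calc (a * (n + 1) + 1) ^ S.card * G.card ≤ ((a + 1) * (n + 1)) ^ S.card * G.card :=
        Nat.mul_le_mul_right _ (Nat.pow_le_pow_left h1 _)
    _ = (a + 1) ^ S.card * G.card * (n + 1) ^ S.card := by rw [mul_pow]; ring

/-- Lower bound for the growth of the powers of the span of `η`, if the `η i` with `i ∈ S` are
algebraically independent. -/
theorem pow_le_finrank_span_pow [Fintype ι] (hη : ∃ j, η j = 1)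
    (hS : AlgebraicIndepOn k η (S : Set ι)) {d n : ℕ} (hd : d * S.card ≤ n) :
    (d + 1) ^ S.card ≤
      Module.finrank k ((Submodule.span k (Set.range η)) ^ n : Submodule k E) := by
  classical
  set H := Submodule.span k (Set.range η)
  have hηH : ∀ i, η i ∈ H := fun i => Submodule.subset_span ⟨i, rfl⟩
  have h1H : (1 : E) ∈ H := by
    obtain ⟨j, hj⟩ := hη
    exact hj ▸ hηH j
  have hprod : ∀ (T : Finset S) (β : S → ℕ), ∏ i ∈ T, η i ^ β i ∈ H ^ (∑ i ∈ T, β i) := by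
    intro T β
    induction T using Finset.induction_on with
    | empty => simp
    | insert i T hi ih =>
      rw [Finset.prod_insert hi, Finset.sum_insert hi, pow_add]
      exact Submodule.mul_mem_mul (Submodule.pow_mem_pow _ (hηH i) _) ih
  let f : (S → Fin (d + 1)) → E := fun β => ∏ i : S, η i ^ (β i : ℕ)
  have hfH : ∀ β, f β ∈ H ^ n := by
    intro β
    have hsum : ∑ i, (β i : ℕ) ≤ n := by
      refine le_trans (Finset.sum_le_sum fun i _ => Nat.lt_succ_iff.mp (β i).2) ?_
      simpa [mul_comm] using hd
    have h := Submodule.mul_mem_mul (hprod Finset.univ fun i => β i)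
      (Submodule.pow_mem_pow H h1H (n - ∑ i, (β i : ℕ)))
    rwa [← pow_add, Nat.add_sub_cancel' hsum, one_pow, mul_one] at h
  have hli : LinearIndependent k f := by
    have h1 : LinearIndependent k fun β : S →₀ ℕ =>
        MvPolynomial.aeval (R := k) (fun i : S => η i) (MvPolynomial.monomial β 1) := by
      have h2 := (MvPolynomial.basisMonomials S k).linearIndependent.map'
        (MvPolynomial.aeval (R := k) (fun i : S => η i)).toLinearMap
        (LinearMap.ker_eq_bot.mpr hS)
      simpa [Function.comp_def] using h2
    have h3 := h1.comp (fun β : S → Fin (d + 1) => Finsupp.equivFunOnFinite.symm fun i => (β i : ℕ))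
      (by
        intro β β' h
        funext i
        have := DFunLike.congr_fun h i
        exact Fin.ext (by simpa using this))
    convert! h3 using 1
    funext β
    simp [f, MvPolynomial.aeval_monomial, Finsupp.prod_fintype]
  have hfin : FiniteDimensional k (H ^ n : Submodule k E) := by
    have : (H ^ n).FG := (Submodule.fg_span (Set.finite_range η)).pow n
    exact Module.Finite.iff_fg.mpr this
  have h4 := finrank_span_eq_card hli
  rw [Fintype.card_fun, Fintype.card_fin, Fintype.card_coe] at h4
  rw [← h4]
  refine Submodule.finrank_mono (Submodule.span_le.mpr ?_)
  rintro _ ⟨β, rfl⟩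
  exact hfH β

lemma exists_algebraicIndepOn_forall_isAlgebraic [Fintype ι] (η : ι → E) :
    ∃ S : Finset ι, AlgebraicIndepOn k η (S : Set ι) ∧
      ∀ i, IsAlgebraic (Algebra.adjoin k (η '' S)) (η i) := by
  classical
  obtain ⟨S, hS, hmax⟩ := Finset.exists_max_image
    (Finset.univ.filter fun S : Finset ι => AlgebraicIndepOn k η (S : Set ι)) Finset.card
    ⟨∅, by
      rw [Finset.mem_filter]
      refine ⟨Finset.mem_univ _, ?_⟩
      rw [Finset.coe_empty, AlgebraicIndepOn, algebraicIndependent_empty_type_iff]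
      exact (algebraMap k E).injective⟩
  have hS' : AlgebraicIndepOn k η (S : Set ι) := (Finset.mem_filter.mp hS).2
  refine ⟨S, hS', fun i => ?_⟩
  by_contra hi
  have hins := hS'.insert hi
  by_cases hiS : i ∈ S
  · exact hi (isAlgebraic_algebraMap
      (⟨η i, Algebra.subset_adjoin ⟨i, hiS, rfl⟩⟩ : Algebra.adjoin k (η '' S)))
  · have := hmax (insert i S) (by simpa using hins)
    rw [Finset.card_insert_of_notMem hiS] at this
    omega

end Growth

/-! ### A lower bound for degrees of divisors -/

lemma MvPolynomial.IsHomogeneous.aeval_const_mul {σ k K : Type*} [Fintype σ] [CommSemiring k]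
    [CommSemiring K] [Algebra k K] {F : MvPolynomial σ k} {n : ℕ} (hF : F.IsHomogeneous n) (c : K)
    (y : σ → K) : MvPolynomial.aeval (fun i => c * y i) F = c ^ n * MvPolynomial.aeval y F := by
  rw [MvPolynomial.aeval_def, MvPolynomial.aeval_def, MvPolynomial.eval₂_eq',
    MvPolynomial.eval₂_eq', Finset.mul_sum]
  refine Finset.sum_congr rfl fun d hd => ?_
  have h : ∑ i, d i = n := by
    rw [← Finsupp.degree_eq_sum]
    by_contra h
    exact MvPolynomial.mem_support_iff.mp hd (hF.coeff_eq_zero h)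
  simp_rw [mul_pow]
  rw [Finset.prod_mul_distrib, Finset.prod_pow_eq_pow_sum, h]
  ring

namespace ProjectiveModel

variable {k : Type*} {K : Type uL} [Field k] [Finite k] [Field K] [Algebra k K] (V : ProjectiveModel k K)

/-- The coordinates of the center of a valuation, in its residue field, and the Hilbert function
in terms of them. -/
lemma exists_residue_coord (v : Valuation K ℤᵐ⁰) :
    ∃ (E : Type uL) (_ : Field E) (_ : Algebra k E) (η : Fin (V.M + 1) → E), (∃ j, η j = 1) ∧
      ∀ n, V.hilbert v n =
        Module.finrank k ((Submodule.span k (Set.range η)) ^ n : Submodule k E) := by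
  obtain ⟨j, -, hj⟩ := Finset.exists_mem_eq_sup (Finset.univ : Finset (Fin (V.M + 1)))
    Finset.univ_nonempty fun i => v (V.coord i)
  change V.maxVal v = v (V.coord j) at hj
  have hpos := V.maxVal_pos v
  have hj0 : V.coord j ≠ 0 := by
    rw [hj, zero_lt_iff] at hpos
    exact (Valuation.ne_zero_iff v).mp hpos
  let y : Fin (V.M + 1) → v.valuationSubring := fun i => ⟨V.coord i / V.coord j, by
    rw [Valuation.mem_valuationSubring_iff, map_div₀]
    refine div_le_one_of_le₀ ?_ zero_le
    rw [← hj]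
    exact Finset.le_sup (f := fun i => v (V.coord i)) (Finset.mem_univ i)⟩
  let _ : Algebra k v.valuationSubring :=
    ((algebraMap k K).codRestrict v.valuationSubring.toSubring (val_base_le_one v)).toAlgebra
  let s : v.valuationSubring →ₐ[k] K := { v.valuationSubring.subtype with commutes' := fun _ => rfl }
  let r : v.valuationSubring →ₐ[k] IsLocalRing.ResidueField v.valuationSubring :=
    { IsLocalRing.residue v.valuationSubring with commutes' := fun _ => rfl }
  have hr : ∀ z : v.valuationSubring, r z = 0 ↔ v (s z) < 1 := by
    intro z
    change IsLocalRing.residue _ z = 0 ↔ _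
    rw [IsLocalRing.residue_eq_zero_iff, Valuation.mem_maximalIdeal_iff]
    rfl
  refine ⟨IsLocalRing.ResidueField v.valuationSubring, inferInstance, inferInstance,
    fun i => r (y i), ⟨j, ?_⟩, fun n => ?_⟩
  · have : y j = 1 := Subtype.ext (div_self hj0)
    simp only [this, map_one]
  let g : MvPolynomial.homogeneousSubmodule (Fin (V.M + 1)) k n →ₗ[k]
      IsLocalRing.ResidueField v.valuationSubring :=
    (MvPolynomial.aeval fun i => r (y i)).toLinearMap ∘ₗ Submodule.subtype _
  -- Dividing by a coordinate of maximal value gives a point of the residue field, and vanishing on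
  -- the center means vanishing at this point.
  have hker : V.vanishing v n = LinearMap.ker g := by
    ext F
    have h1 : V.coord = fun i => V.coord j * s (y i) := by
      funext i
      exact (mul_div_cancel₀ (V.coord i) hj0).symm
    have h2 : MvPolynomial.aeval V.coord (F : MvPolynomial (Fin (V.M + 1)) k) =
        V.coord j ^ n * s (MvPolynomial.aeval y (F : MvPolynomial (Fin (V.M + 1)) k)) := by
      conv_lhs => rw [h1]
      rw [MvPolynomial.IsHomogeneous.aeval_const_mul
        ((MvPolynomial.mem_homogeneousSubmodule _ _).mp F.2)]
      congr 1
      exact (MvPolynomial.comp_aeval_apply y s _).symm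
    have h3 : g F = r (MvPolynomial.aeval y (F : MvPolynomial (Fin (V.M + 1)) k)) :=
      (MvPolynomial.comp_aeval_apply y r _).symm
    rw [LinearMap.mem_ker, h3, hr]
    change v _ < V.maxVal v ^ n ↔ _
    rw [h2, map_mul, map_pow, ← hj]
    rw [mul_lt_iff_lt_one_right (pow_pos hpos n)]
  rw [hilbert, hker, g.quotKerEquivRange.finrank_eq, LinearMap.range_comp, Submodule.range_subtype,
    ← MvPolynomial.homogeneousSubmodule_one_pow, Submodule.map_pow,
    MvPolynomial.homogeneousSubmodule_one_eq_span_X, Submodule.map_span, ← Set.range_comp]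
  have h : (⇑(MvPolynomial.aeval (R := k) fun i => r (y i)).toLinearMap ∘ MvPolynomial.X) =
      fun i => r (y i) := by
    funext i
    simp
  rw [h]

/-- The nonzero degrees of divisors are bounded below in terms of the dimension. -/
theorem le_deg_of_ne_zero {v : Valuation K ℤᵐ⁰} (hv : V.deg v ≠ 0) :
    ((V.dim - 1).factorial : ℝ) / ((V.dim - 1 : ℕ) : ℝ) ^ (V.dim - 1) ≤ V.deg v := by
  obtain ⟨E, _, _, η, hη, hH⟩ := V.exists_residue_coord v
  obtain ⟨S, hS, hSalg⟩ := exists_algebraicIndepOn_forall_isAlgebraic (k := k) η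
  set M := V.dim - 1 with hM
  have hdeg : V.deg v = Filter.limsup (fun n : ℕ =>
    (M.factorial : ℝ) * (V.hilbert v n : ℝ) / (n : ℝ) ^ M) Filter.atTop := rfl
  -- With fewer than M independent coordinates the Hilbert function is o(n ^ M) and the degree is 0.
  -- With at least M of them, monomials with exponents at most n / M already give (n / M + 1) ^ M ≥
  -- (n / M) ^ M, the first quotient rounded down.
  rcases lt_or_ge S.card M with hlt | hge
  · refine absurd ?_ hv
    rw [hdeg]
    refine Filter.Tendsto.limsup_eq ?_
    obtain ⟨D, hD⟩ := exists_finrank_span_pow_le hSalg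
    have h1 : Filter.Tendsto (fun n : ℕ => (M.factorial * D * 2 ^ S.card : ℝ) * (n : ℝ)⁻¹)
        Filter.atTop (nhds 0) := by
      simpa using tendsto_inv_atTop_nhds_zero_nat.const_mul (M.factorial * D * 2 ^ S.card : ℝ)
    refine squeeze_zero' (Filter.Eventually.of_forall fun n => by positivity) ?_ h1
    filter_upwards [Filter.eventually_ge_atTop 1] with n hn
    have hn' : (1 : ℝ) ≤ n := by exact_mod_cast hn
    have hn0 : (0 : ℝ) < n := by linarith
    have h2 : (V.hilbert v n : ℝ) ≤ D * (n + 1) ^ S.card := by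
      rw [hH]
      exact_mod_cast hD n
    have h3 : ((n : ℝ) + 1) ^ S.card ≤ 2 ^ S.card * n ^ S.card := by
      rw [← mul_pow]
      exact pow_le_pow_left₀ (by positivity) (by linarith) _
    have h4 : (n : ℝ) ^ S.card * n ≤ n ^ M := by
      rw [← pow_succ]
      exact pow_le_pow_right₀ hn' hlt
    rw [div_le_iff₀ (by positivity)]
    calc (M.factorial : ℝ) * V.hilbert v n
        ≤ M.factorial * (D * (2 ^ S.card * n ^ S.card)) := by
          gcongr
          exact h2.trans (by gcongr)
      _ = (M.factorial * D * 2 ^ S.card : ℝ) * (n : ℝ)⁻¹ * (n ^ S.card * n) := by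
          field_simp
      _ ≤ _ := by gcongr
  · obtain ⟨S', hS', hcard⟩ := Finset.exists_subset_card_eq hge
    have hlow : ∀ n : ℕ, 1 ≤ n → (M.factorial : ℝ) / (M : ℝ) ^ M ≤
        (M.factorial : ℝ) * (V.hilbert v n : ℝ) / (n : ℝ) ^ M := by
      intro n hn
      have hn0 : (0 : ℝ) < n := by exact_mod_cast hn
      have h1 := pow_le_finrank_span_pow (n := n) (d := n / M) hη
        (hS.mono (Finset.coe_subset.mpr hS')) (by rw [hcard]; exact Nat.div_mul_le_self n M)
      rw [← hH, hcard] at h1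
      have h2 : n ^ M ≤ M ^ M * V.hilbert v n := by
        refine le_trans ?_ (Nat.mul_le_mul_left _ h1)
        rw [← mul_pow]
        rcases Nat.eq_zero_or_pos M with h0 | h0
        · simp [h0]
        · refine Nat.pow_le_pow_left ?_ _
          have := Nat.lt_mul_div_succ n h0
          exact this.le
      have h3 : (n : ℝ) ^ M ≤ (M : ℝ) ^ M * V.hilbert v n := by exact_mod_cast h2
      have h4 : (0 : ℝ) < (M : ℝ) ^ M := by
        rcases Nat.eq_zero_or_pos M with h0 | h0
        · simp [h0]
        · positivity
      rw [div_le_div_iff₀ h4 (by positivity)]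
      calc (M.factorial : ℝ) * n ^ M ≤ M.factorial * ((M : ℝ) ^ M * V.hilbert v n) := by gcongr
        _ = _ := by ring
    rw [hdeg, Filter.limsup_eq]
    refine le_csInf ?_ fun b hb => ?_
    -- If the quotients had no eventual upper bound, the real `limsup` would take its default value
    -- 0, which `hv` excludes.
    · by_contra h
      rw [Set.not_nonempty_iff_eq_empty] at h
      exact hv (by rw [hdeg, Filter.limsup_eq, h, Real.sInf_empty])
    · obtain ⟨n, hn1, hn⟩ := ((Filter.eventually_ge_atTop 1).and hb).exists
      exact (hlow n hn1).trans hn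

end ProjectiveModel

/-! ### The main theorem -/

lemma Nat.exists_lt_pow_le {q : ℕ} (hq : 1 < q) (N : ℕ) :
    ∃ T : ℕ, N < q ^ T ∧ q ^ T ≤ q * (N + 1) := by
  refine ⟨Nat.log q N + 1, Nat.lt_pow_succ_log_self hq N, ?_⟩
  rw [pow_succ, mul_comm]
  refine Nat.mul_le_mul_left q ?_
  rcases eq_or_ne N 0 with rfl | hN
  · simp
  · exact (Nat.pow_log_le_self q hN).trans (Nat.le_succ N)

namespace DrinfeldModule

variable {Fq A K : Type*} [Field Fq] [Finite Fq] [CommRing A] [IsDomain A] [Algebra Fq A]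
  [Field K] [Algebra Fq K] {i : A →ₐ[Fq] K} (φ : DrinfeldModule i)

lemma limitOrd_nonpos (htr : Algebra.trdeg Fq A ≤ 1) {a : A} (ha : Transcendental Fq a)
    {L : Type*} [Field L] [Algebra K L] [Algebra Fq L] (w : Valuation L ℤᵐ⁰) (x : L) :
    φ.limitOrd a w x ≤ 0 := by
  obtain ⟨H, hH, hHt, -⟩ := φ.exists_tendsto_truncOrd w htr ha
  rw [hH a ha]
  refine le_of_tendsto' (hHt x) fun n => div_nonpos_of_nonpos_of_nonneg ?_ (Nat.cast_nonneg _)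
  exact_mod_cast truncOrd_nonpos _

end DrinfeldModule

lemma ProjectiveModel.exists_coeffOrd_le_mul_finrank {Fq k : Type*} {K : Type*} [Field Fq]
    [Finite Fq] [Field k] [Field K] [Algebra Fq K] [Algebra k K] (V : ProjectiveModel k K)
    (f : TwistedPoly Fq K) :
    ∃ C : ℕ, ∀ (L : Type uL) [Field L] [Algebra K L] [FiniteDimensional K L],
      ∀ w ∈ V.divisors L, ∀ n ∈ f.support, |f.coeffOrd L w n| ≤ C * Module.finrank K L := by
  have h : ∀ n : ℕ, ∃ C : ℕ, n ∈ f.support →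
      ∀ (L : Type uL) [Field L] [Algebra K L] [FiniteDimensional K L],
      ∀ w ∈ V.divisors L, |f.coeffOrd L w n| ≤ C * Module.finrank K L := by
    intro n
    by_cases hn : n ∈ f.support
    · obtain ⟨C, hC⟩ := V.exists_log_le_mul_finrank (TwistedPoly.mem_support.mp hn)
      refine ⟨C, fun _ L _ _ _ w hw => ?_⟩
      rw [TwistedPoly.coeffOrd, abs_neg]
      exact hC L w hw
    · exact ⟨0, fun h => absurd h hn⟩
  choose C hC using h
  refine ⟨f.support.sup C, fun L _ _ _ w hw n hn => (hC n hn L w hw).trans ?_⟩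
  have := Finset.le_sup (f := C) hn
  gcongr

end

theorem theoremT
    {Fq F K : Type*} [Field Fq] [Finite Fq]
    [Field F] [Algebra Fq F] (hF : (⊤ : IntermediateField Fq F).FG)
    (hF1 : Algebra.trdeg Fq F = 1) (infty : CurvePlace Fq F)
    [Field K] [Algebra Fq K] (hK : (⊤ : IntermediateField Fq K).FG)
    (i : regularAwayFrom infty →ₐ[Fq] K) (φ : DrinfeldModule i)
    (hφ : φ.IsFiniteCharacteristic) :
    ∃ k : ℝ, 0 < k ∧ ∀ (κ : IntermediateField Fq K) [Finite κ] (V : ProjectiveModel κ K), ∃ C : ℝ, 0 < C ∧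
      ∀ a : regularAwayFrom infty, Transcendental Fq a →
        ∀ x : AlgebraicClosure K, ∀ v ∈ V.divisors (IntermediateField.adjoin K {x}),
          0 < φ.localHeight V a v (IntermediateField.AdjoinSimple.gen K x) →
            C / (Module.finrank K (IntermediateField.adjoin K {x}) : ℝ) ^ k ≤
              φ.localHeight V a v (IntermediateField.AdjoinSimple.gen K x) := by
  have htr : Algebra.trdeg Fq (regularAwayFrom infty) ≤ 1 :=
    hF1 ▸ trdeg_le_of_injective (regularAwayFrom infty).val Subtype.val_injective
  obtain ⟨t, ht, ht0⟩ := hφ.exists_transcendental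
  set f := φ.toRingHom t with hf
  set r := f.tauDegree with hr
  set m := f.support.card * f.support.card * r + 1 with hm
  set q := Nat.card Fq with hq
  have hq1 : 1 < q := Finite.one_lt_card
  -- The part r m comes from (q ^ r) ^ (T m) = (q ^ T) ^ (r m) with q ^ T linear in d, the 1 from
  -- the factor 1 / [L : K] of the height.
  refine ⟨((r * m + 1 : ℕ) : ℝ), by positivity, fun κ _ V => ?_⟩
  obtain ⟨C₀, hC₀⟩ := V.exists_coeffOrd_le_mul_finrank f
  set M := V.dim - 1 with hM
  -- Chosen so that q ^ T ≤ B d for the T taken below with c = C₀ d.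
  set B := q * (2 * C₀ * q ^ r + 1) with hB
  have hB0 : 0 < B := by positivity
  have hMM : (0 : ℝ) < (M.factorial : ℝ) / (M : ℝ) ^ M := by
    rcases Nat.eq_zero_or_pos M with h0 | h0
    · simp [h0]
    · positivity
  refine ⟨(M.factorial : ℝ) / (M : ℝ) ^ M * ((B : ℝ) ^ (r * m))⁻¹, by positivity,
    fun a ha x v hv hpos => ?_⟩
  have : FiniteDimensional K (IntermediateField.adjoin K {x}) :=
    IntermediateField.adjoin.finiteDimensional (Algebra.IsIntegral.isIntegral x)
  set d := Module.finrank K (IntermediateField.adjoin K {x}) with hd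
  have hd0 : 0 < d := Module.finrank_pos
  obtain ⟨T, hT, hT'⟩ := Nat.exists_lt_pow_le hq1 (2 * (C₀ * d) * q ^ r)
  have hl0 := φ.limitOrd_nonpos htr ha v (IntermediateField.AdjoinSimple.gen K x)
  rw [DrinfeldModule.localHeight] at hpos ⊢
  have hne := hpos.ne'
  have hl : φ.limitOrd a v (IntermediateField.AdjoinSimple.gen K x) < 0 :=
    lt_of_le_of_ne hl0 (right_ne_zero_of_mul hne)
  -- A positive height forces the degree and the residue degree, either of which could be 0 by
  -- default, to be nonzero.
  have hne' := div_ne_zero_iff.mp (neg_ne_zero.mp (left_ne_zero_of_mul hne))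
  have hdeg := V.le_deg_of_ne_zero (left_ne_zero_of_mul hne'.1)
  have hres : (1 : ℝ) ≤ residueDegree K v := by
    exact_mod_cast Nat.one_le_iff_ne_zero.mpr
      (Nat.cast_ne_zero.mp (right_ne_zero_of_mul hne'.1))
  have hlim := φ.limitOrd_le_of_neg v htr ht ht0 (c := C₀ * d)
    (fun n hn => by exact_mod_cast hC₀ _ v hv n hn) hT ha hl
  rw [← hf, ← hr, ← hm] at hlim
  have hpow : ((f.deg : ℝ) ^ (T * m)) ≤ (B * d : ℝ) ^ (r * m) := by
    have h1 : q ^ T ≤ B * d := by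
      refine hT'.trans ?_
      rw [hB, mul_assoc q]
      refine Nat.mul_le_mul_left q ?_
      rw [add_mul, one_mul]
      have : 2 * (C₀ * d) * q ^ r = 2 * C₀ * q ^ r * d := by ring
      omega
    have h2 : f.deg ^ (T * m) = (q ^ T) ^ (r * m) := by
      rw [TwistedPoly.deg_eq, ← hr, ← hq, ← pow_mul, ← pow_mul]
      ring_nf
    have h3 := Nat.pow_le_pow_left h1 (r * m)
    rw [← h2] at h3
    exact_mod_cast h3
  have hdegpos : (0 : ℝ) < (f.deg : ℝ) ^ (T * m) := by
    have : 0 < f.deg := pow_pos Nat.card_pos _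
    positivity
  have hlim' : ((B * d : ℝ) ^ (r * m))⁻¹ ≤
      -φ.limitOrd a v (IntermediateField.AdjoinSimple.gen K x) :=
    (inv_anti₀ hdegpos hpow).trans (le_neg_of_le_neg hlim)
  have hd1 : (0 : ℝ) < d := by exact_mod_cast hd0
  rw [Real.rpow_natCast]
  calc (M.factorial : ℝ) / (M : ℝ) ^ M * ((B : ℝ) ^ (r * m))⁻¹ / (d : ℝ) ^ (r * m + 1)
      = (M.factorial : ℝ) / (M : ℝ) ^ M * 1 / d * ((B * d : ℝ) ^ (r * m))⁻¹ := by
        rw [mul_pow, pow_succ]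
        field_simp
    _ ≤ V.deg (v.comap (algebraMap K _)) * residueDegree K v / d *
        -φ.limitOrd a v (IntermediateField.AdjoinSimple.gen K x) := by
        have := hMM.trans_le hdeg
        gcongr
    _ = _ := by ring
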